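/- **Model.** There are $n$ parties; time is divided into slots $0,1,2,\dots$. An oblivious adversary fixes in advance a wake-up time $t_u\in\{0,1,2,\dots\}$ for each party $u$. A (LocalClock, acknowledgment-based) protocol is a probability distribution $\mathcal D$ on $0/1$-sequences $(X_1,X_2,\dots)$. Each party $u$ independently draws $X^{(u)}\sim\mathcal D$ and attempts to grab the resource at global time $t>t_u$ iff $X^{(u)}_{t-t_u}=1$ and $u$ has not succeeded before time $t$. Party $u$ succeeds at time $t$ iff it is the only party attempting to grab at time $t$; its latency is (its success time) $-\,t_u$, or $\infty$ if it never succeeds. The protocol is *memoryless* if $X_1,X_2,\dots$ are independent under $\mathcal D$; put $p(i)=\Pr[X_i=1]$. **Definitions.** - $L_{\mathcal D}(n,q)$ is the least integer $L\ge 0$ such that, for every oblivious adversary with $n$ parties and every party $u$, the latency of $u$ is at most $L$ with probability at least $1-q$ ($L_{\mathcal D}(n,q)=\infty$ if there is no such $L$). - The restricted time window $\tilde T_{\mathcal D}(n)$ is the largest integer $T\ge 0$ for which there is an oblivious adversary that activates at most $2n/3$ parties in $[0,T]$, and under which some party $u^*$ activated at time $0$ succeeds in $[1,T]$ with probability at most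 $1-4^{-1/8}$. - For $\beta>0$ let $B_\beta(t)=1$ for $1\le t\le 16$ and $B_\beta(t)=\min(1,\ln^\beta t/t)$ for $t>16$. Let $s^{\mathrm{low}_\beta}(k)=\sum_{i=1}^{k}p(i)\,\mathbf 1\{p(i)\le B_\beta(i)\}$. **Theorem.** Let $\mathcal D$ be a memoryless protocol with $p(1)>0$, let $\beta\ge 10$ be a real constant, and let the error probability be either $q(n)=1/2$ for all $n$, or $q(n)=n^{-2}$ for all $n$. Suppose that $L_{\mathcal D}(n,q(n))=o(n\log^{\beta/2-1}n)$ as $n\to\infty$ (in particular $L_{\mathcal D}(n,q(n))$ is finite for all sufficiently large $n$). Then for all sufficiently large $n$ the restricted time window $\tilde T_{\mathcal D}(n)$ exists (the largest such $T$ is attained) and $$\tilde T_{\mathcal D}(n)\ \ge\ \left\lfloor \frac{n\left(s^{\mathrm{low}_\beta}(\lfloor n/\ln^2 n\rfloor)-s^{\mathrm{low}_\beta}(\lfloor\sqrt n\rfloor)\right)}{40\,\beta\,\ln\ln n}\right\rfloor .$$ -/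

import Mathlib

open MeasureTheory ProbabilityTheory Filter Asymptotics

namespace ContentionResolution

/-- A party's choices: entry `i ≥ 1` tells whether it tries to grab the resource at local time `i`.
Entry `0` is never read. A `LocalClock` protocol is a probability measure on `Choices`. -/
abbrev Choices : Type := ℕ → Bool

/-- An oblivious adversary with `n` parties: it fixes all wake-up times in advance. -/
abbrev Schedule (n : ℕ) : Type := Fin n → ℕ

/-- The decision at each local time `1, 2, 3, …` is independent of the earlier ones. -/
def IsMemoryless (D : Measure Choices) : Prop :=
  iIndepFun (fun (i : ℕ) (X : Choices) => X (i + 1)) D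

/-- `p(i)`, the probability that a party's choice at local time `i` is to grab. -/
noncomputable def accessProb (D : Measure Choices) (i : ℕ) : ℝ :=
  D.real {X | X i = true}

/-- The parties that attempt to grab the resource at global time `t`, when `S` is the set of
parties that succeeded before time `t`. A party that wakes up at time `a` has local time `t - a`
at global time `t`, and acts only at local times `≥ 1`. -/
def grabbers {n : ℕ} (w : Schedule n) (X : Fin n → Choices) (S : Finset (Fin n)) (t : ℕ) :
    Finset (Fin n) :=
  Finset.univ.filter fun u => w u < t ∧ u ∉ S ∧ X u (t - w u) = true

/-- The parties that have achieved success at a global time `≤ t`: in each slot, a party succeeds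
iff it is the only one that attempts to grab the resource, and it then leaves the system. -/
def succeeded {n : ℕ} (w : Schedule n) (X : Fin n → Choices) : ℕ → Finset (Fin n)
  | 0 => ∅
  | t + 1 =>
    if (grabbers w X (succeeded w X t) (t + 1)).card = 1 then
      succeeded w X t ∪ grabbers w X (succeeded w X t) (t + 1)
    else succeeded w X t

/-- The global time at which `u` achieves success (`⊤` if this never happens). -/
noncomputable def successTime {n : ℕ} (w : Schedule n) (X : Fin n → Choices) (u : Fin n) : ℕ∞ :=
  ⨅ (t : ℕ) (_ : u ∈ succeeded w X t), (t : ℕ∞)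

/-- The latency of party `u`. -/
noncomputable def latency {n : ℕ} (w : Schedule n) (X : Fin n → Choices) (u : Fin n) : ℕ∞ :=
  successTime w X u - (w u : ℕ∞)

/-- The joint law of the choices of `n` parties: independent copies of `D`. -/
noncomputable def jointLaw (D : Measure Choices) (n : ℕ) : Measure (Fin n → Choices) :=
  Measure.pi fun _ => D

/-- `L_D(n, q)`: the least `L` such that, against every oblivious adversary with `n` parties, every
party has latency at most `L` with probability at least `1 - q` (`⊤` if there is no such `L`). -/
noncomputable def latencyBound (D : Measure Choices) (n : ℕ) (q : ℝ) : ℕ∞ :=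
  ⨅ (L : ℕ) (_ : ∀ (w : Schedule n) (u : Fin n),
    1 - q ≤ (jointLaw D n).real {X | latency w X u ≤ (L : ℕ∞)}), (L : ℕ∞)

/-- Some oblivious adversary activates at most `2n/3` parties in `[0, T]`, among them a party `u`
at time `0` that succeeds in `[1, T]` with probability at most `1 - 4^(-1/8)`. -/
def IsBlockable (D : Measure Choices) (n T : ℕ) : Prop :=
  ∃ w : Schedule n,
    (∃ u : Fin n, w u = 0 ∧
      (jointLaw D n).real {X | 1 ≤ successTime w X u ∧ successTime w X u ≤ (T : ℕ∞)}
        ≤ 1 - (4 : ℝ) ^ (-(1 / 8) : ℝ)) ∧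
    (((Finset.univ.filter fun v => w v ≤ T).card : ℕ) : ℝ) ≤ 2 * (n : ℝ) / 3

/-- `T` is the restricted time window of `D` for `n` parties. -/
def IsRestrictedTimeWindow (D : Measure Choices) (n T : ℕ) : Prop :=
  IsGreatest {T' : ℕ | IsBlockable D n T'} T

/-- The threshold `B_β`. -/
noncomputable def threshold (β : ℝ) (t : ℕ) : ℝ :=
  if t ≤ 16 then 1 else min 1 (Real.log t ^ β / t)

open Classical in
/-- `p^{low_β}(i) = p(i) · 1{p(i) ≤ B_β(i)}`. -/
noncomputable def lowProb (D : Measure Choices) (β : ℝ) (i : ℕ) : ℝ :=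
  if accessProb D i ≤ threshold β i then accessProb D i else 0

/-- `s^{low_β}(k)`, the sum of `p^{low_β}(i)` over `1 ≤ i ≤ k`. -/
noncomputable def lowSum (D : Measure Choices) (β : ℝ) (k : ℕ) : ℝ :=
  ∑ i ∈ Finset.Icc 1 k, lowProb D β i

end ContentionResolution

open ContentionResolution

/-! The adversary blocks a party `u` woken at time 0 by keeping the contention (the sum of the
attempt probabilities of the awake, unfinished parties) high in every slot. With contention at least
`c`, a slot has a single attempt with probability at most `2 exp (-c/2)`, and `u` is that single one
with probability at most `2 exp (-c/2)` times its own attempt probability. Summing over slots then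
costs the sum of `accessProb` up to `T` instead of `T`. This sum is polylogarithmic: otherwise
uniformly spread arrivals would keep the contention of order `log n` beyond the latency bound, and
probably nobody would succeed (`eventually_sum_accessProb_le`). Hence `c = 5 β log log n` is enough.

Contention `2c` without departures comes from `n / 2` parties with arrival times in `[0, T)`. For
uniform arrivals the mean contention from low probabilities at ages in `(√n, k]`, where `k = ⌊n /
log² n⌋`, is at least `(n / 2) Δ / T`, with `Δ` the increment of `lowSum`; the choice of `T` makes
this about `20 β log log n`. Each term is at most `log^β n / √n`, so a Chernoff bound holds at all
times simultaneously, and averaging fixes the arrivals (`exists_arrivals`). Slots before `k`, where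
the ages have not built up, are covered by bursts of `O(log n)` new parties, using `p(1) > 0`; they
take only `o(n)` parties (`exists_schedule`).

Departures must not destroy the contention. A party that left `a` slots ago removes at most
`envelope β n a`. While the contention is at least `c`, successes are rare even conditionally on the
past, and an exponential moment bound shows that the removed weight stays below `c`; induction on
time closes the loop (`contention_ge_of_calm`, `prob_mem_succeeded_le`). Finally, blockable times
lie below the latency bound, so a largest one exists (`exists_isRestrictedTimeWindow`). -/

namespace ContentionResolution

/-! ### Independence of the choices of different parties and slots. -/

section Independence

instance instIsProbabilityMeasureJointLaw (D : Measure Choices) [IsProbabilityMeasure D] (n : ℕ) :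
    IsProbabilityMeasure (jointLaw D n) := by
  unfold jointLaw; infer_instance

/-- The choices of all parties at all positive local times are mutually independent. -/
theorem iIndepFun_jointLaw {D : Measure Choices} [IsProbabilityMeasure D] (hD : IsMemoryless D)
    (n : ℕ) :
    iIndepFun (fun (p : Fin n × ℕ) (X : Fin n → Choices) => X p.1 (p.2 + 1)) (jointLaw D n) := by
  refine iIndepFun_uncurry' (X := fun (u : Fin n) (i : ℕ) (X : Fin n → Choices) => X u (i + 1))
    (by fun_prop) ?_ ?_
  · exact iIndepFun_pi (X := fun (_ : Fin n) (x : Choices) (i : ℕ) => x (i + 1))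
      (fun _ => Measurable.aemeasurable (by fun_prop))
  · intro u
    have hmp := measurePreserving_eval (fun _ : Fin n => D) u
    have h2 : ∀ f : Choices → ℕ → Bool, Measurable f →
        (jointLaw D n).map (fun X => f (X u)) = D.map f := by
      intro f hf
      exact (Measure.map_map hf hmp.measurable).symm.trans (congrArg (Measure.map f) hmp.map_eq)
    have h3 : ∀ f : Choices → Bool, Measurable f →
        (jointLaw D n).map (fun X => f (X u)) = D.map f := by
      intro f hf
      exact (Measure.map_map hf hmp.measurable).symm.trans (congrArg (Measure.map f) hmp.map_eq)
    have h4 := (iIndepFun_iff_map_fun_eq_infinitePi_map (by fun_prop)).1 hD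
    refine (iIndepFun_iff_map_fun_eq_infinitePi_map (by fun_prop)).2 ?_
    rw [h2 (fun x i => x (i + 1)) (by fun_prop), h4]
    congr 1
    funext i
    rw [h3 (fun x => x (i + 1)) (by fun_prop)]

/-- `φ` is determined by the choices with indices in `P` (the pair `(u, i)` stands for the choice
of `u` at local time `i + 1`). -/
def DependsOnChoices {n : ℕ} {α : Type*} (P : Finset (Fin n × ℕ))
    (φ : (Fin n → Choices) → α) : Prop :=
  ∀ X X' : Fin n → Choices, (∀ p ∈ P, X p.1 (p.2 + 1) = X' p.1 (p.2 + 1)) → φ X = φ X'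

/-- A choice matrix that extends a finite tuple of choices. -/
def extendChoices {n : ℕ} (P : Finset (Fin n × ℕ)) (z : P → Bool) : Fin n → Choices :=
  fun u j => if h : (u, j - 1) ∈ P then z ⟨_, h⟩ else false

namespace DependsOnChoices

variable {n : ℕ} {α γ δ : Type*} {P Q : Finset (Fin n × ℕ)} {φ : (Fin n → Choices) → α}

/-- Factoring through the finite type `P → Bool` is what makes measurability and integrability
automatic and reduces independence to that of finite blocks of choices. -/
theorem eq_extend (h : DependsOnChoices P φ) :
    φ = (fun z => φ (extendChoices P z)) ∘
      fun (X : Fin n → Choices) (p : P) => X p.1.1 (p.1.2 + 1) := by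
  funext X
  refine h _ _ ?_
  rintro ⟨u, i⟩ hp
  simp [extendChoices, hp]

theorem measurable [MeasurableSpace α] (h : DependsOnChoices P φ) : Measurable φ := by
  rw [h.eq_extend]
  exact (measurable_of_finite _).comp (by fun_prop)

theorem mono (h : DependsOnChoices P φ) (hPQ : P ⊆ Q) : DependsOnChoices Q φ :=
  fun X X' hX => h X X' fun p hp => hX p (hPQ hp)

theorem comp (h : DependsOnChoices P φ) (F : α → γ) : DependsOnChoices P fun X => F (φ X) :=
  fun X X' hX => congrArg F (h X X' hX)

theorem comp₂ {ψ : (Fin n → Choices) → γ} (h : DependsOnChoices P φ) (h' : DependsOnChoices P ψ)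
    (F : α → γ → δ) : DependsOnChoices P fun X => F (φ X) (ψ X) :=
  fun X X' hX => by simp only [h X X' hX, h' X X' hX]

theorem integrable {φ : (Fin n → Choices) → ℝ} (h : DependsOnChoices P φ)
    (μ : Measure (Fin n → Choices)) [IsFiniteMeasure μ] : Integrable φ μ := by
  obtain ⟨C, hC⟩ := (Set.finite_range fun z => ‖φ (extendChoices P z)‖).bddAbove
  refine Integrable.of_bound h.measurable.aestronglyMeasurable C (ae_of_all _ fun X => ?_)
  rw [h.eq_extend]
  exact hC ⟨_, rfl⟩

theorem integral_mul {D : Measure Choices} [IsProbabilityMeasure D] (hD : IsMemoryless D)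
    {φ ψ : (Fin n → Choices) → ℝ} (hφ : DependsOnChoices P φ) (hψ : DependsOnChoices Q ψ)
    (hPQ : Disjoint P Q) :
    ∫ X, φ X * ψ X ∂(jointLaw D n) = (∫ X, φ X ∂(jointLaw D n)) * ∫ X, ψ X ∂(jointLaw D n) := by
  have hi := (iIndepFun_jointLaw hD n).indepFun_finset P Q hPQ (by fun_prop)
  have h2 : IndepFun φ ψ (jointLaw D n) := by
    rw [hφ.eq_extend, hψ.eq_extend]
    exact hi.comp (measurable_of_finite _) (measurable_of_finite _)
  exact h2.integral_fun_mul_eq_mul_integral hφ.measurable.aestronglyMeasurable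
    hψ.measurable.aestronglyMeasurable

end DependsOnChoices

/-- The choices made at global times `≤ t`. -/
def pastChoices {n : ℕ} (w : Schedule n) (t : ℕ) : Finset (Fin n × ℕ) :=
  (Finset.univ ×ˢ Finset.range t).filter fun p => w p.1 + p.2 + 1 ≤ t

/-- The choices made at global time `t`. -/
def slotChoices {n : ℕ} (w : Schedule n) (t : ℕ) : Finset (Fin n × ℕ) :=
  (Finset.univ ×ˢ Finset.range t).filter fun p => w p.1 + p.2 + 1 = t

theorem mem_pastChoices {n : ℕ} {w : Schedule n} {t : ℕ} {p : Fin n × ℕ} :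
    p ∈ pastChoices w t ↔ w p.1 + p.2 + 1 ≤ t := by
  simp [pastChoices]; omega

theorem mem_slotChoices {n : ℕ} {w : Schedule n} {t : ℕ} {p : Fin n × ℕ} :
    p ∈ slotChoices w t ↔ w p.1 + p.2 + 1 = t := by
  simp [slotChoices]; omega

theorem disjoint_past_slot {n : ℕ} (w : Schedule n) (t : ℕ) :
    Disjoint (pastChoices w t) (slotChoices w (t + 1)) := by
  rw [Finset.disjoint_left]
  intro p h1 h2
  rw [mem_pastChoices] at h1
  rw [mem_slotChoices] at h2
  omega

theorem pastChoices_mono {n : ℕ} (w : Schedule n) {s t : ℕ} (h : s ≤ t) :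
    pastChoices w s ⊆ pastChoices w t := fun p hp => by
  rw [mem_pastChoices] at *; omega

theorem slotChoices_subset_past {n : ℕ} (w : Schedule n) (t : ℕ) :
    slotChoices w t ⊆ pastChoices w t := fun p hp => by
  rw [mem_pastChoices]; rw [mem_slotChoices] at hp; omega

/-- Keeping `S` as a fixed parameter is essential: with the random set of departed parties in its
place, the past would enter. -/
theorem dependsOn_grabbers {n : ℕ} (w : Schedule n) (S : Finset (Fin n)) (t : ℕ) :
    DependsOnChoices (slotChoices w t) fun X => grabbers w X S t := by
  intro X X' h
  ext u
  simp only [grabbers, Finset.mem_filter, Finset.mem_univ, true_and]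
  by_cases hu : w u < t
  · have := h (u, t - w u - 1) (by rw [mem_slotChoices]; simp only; omega)
    simp only [show t - w u - 1 + 1 = t - w u by omega] at this
    rw [this]
  · simp [hu]

theorem dependsOn_succeeded {n : ℕ} (w : Schedule n) (t : ℕ) :
    DependsOnChoices (pastChoices w t) fun X => succeeded w X t := by
  induction t with
  | zero => intro X X' _; rfl
  | succ t ih =>
    have h1 := ih.mono (pastChoices_mono w (Nat.le_succ t))
    intro X X' h
    have h2 : succeeded w X t = succeeded w X' t := h1 X X' h
    have h3 := fun S => (dependsOn_grabbers w S (t + 1)).mono (slotChoices_subset_past w _) X X' h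
    simp only at h3
    simp only [succeeded, h2, h3]

end Independence


/-! ### A single slot with a fixed set of departed parties. -/

section OneSlot

open Classical in
/-- The sum of `f` over the ages, at time `t`, of the awake parties outside `S`. -/
noncomputable def contention {n : ℕ} (f : ℕ → ℝ) (w : Schedule n) (S : Finset (Fin n))
    (t : ℕ) : ℝ :=
  ∑ v ∈ Finset.univ.filter (fun v => w v < t ∧ v ∉ S), f (t - w v)

theorem accessProb_nonneg (D : Measure Choices) (i : ℕ) : 0 ≤ accessProb D i :=
  measureReal_nonneg

theorem accessProb_le_one (D : Measure Choices) [IsProbabilityMeasure D] (i : ℕ) :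
    accessProb D i ≤ 1 := measureReal_le_one

theorem measurableSet_choice (i : ℕ) : MeasurableSet {x : Choices | x i = true} :=
  (by fun_prop : Measurable fun x : Choices => x i) (measurableSet_singleton true)

theorem integral_choice (D : Measure Choices) [IsProbabilityMeasure D] (i : ℕ) (a b : ℝ) :
    ∫ x : Choices, (if x i = true then a else b) ∂D = b + (a - b) * accessProb D i := by
  have hm : MeasurableSet {x : Choices | x i = true} :=
    measurableSet_choice i
  have h1 : (fun x : Choices => if x i = true then a else b) =
      fun x => b + (a - b) * ({x : Choices | x i = true}.indicator 1 x) := by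
    funext x
    by_cases hx : x i = true <;> simp [hx]
  rw [h1, integral_add (integrable_const _), integral_const_mul, integral_indicator_one hm]
  · simp [accessProb]
  · exact ((integrable_const (1 : ℝ)).indicator hm).const_mul _

open Classical in
/-- The factor of party `v` in the product that dominates the event of a single attempt. -/
noncomputable def attemptFactor {n : ℕ} (w : Schedule n) (S : Finset (Fin n)) (t : ℕ) (v : Fin n)
    (x : Choices) : ℝ :=
  if w v < t ∧ v ∉ S ∧ x (t - w v) = true then 1 / 2 else 1

theorem prod_attemptFactor {n : ℕ} (w : Schedule n) (S : Finset (Fin n)) (t : ℕ)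
    (X : Fin n → Choices) :
    ∏ v, attemptFactor w S t v (X v) = (1 / 2) ^ (grabbers w X S t).card := by
  simp [attemptFactor, grabbers, Finset.prod_ite]

theorem integral_attemptFactor {n : ℕ} (D : Measure Choices) [IsProbabilityMeasure D]
    (w : Schedule n) (S : Finset (Fin n)) (t : ℕ) (v : Fin n) :
    ∫ x, attemptFactor w S t v x ∂D =
      if w v < t ∧ v ∉ S then 1 - accessProb D (t - w v) / 2 else 1 := by
  unfold attemptFactor
  by_cases h : w v < t ∧ v ∉ S
  · simp only [h, true_and, not_false_eq_true, and_self, if_true]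
    rw [integral_choice]; ring
  · have : ∀ x : Choices, ¬(w v < t ∧ v ∉ S ∧ x (t - w v) = true) := fun x hx => h ⟨hx.1, hx.2.1⟩
    simp only [this, if_false, h]
    simp

/-- Each awake party contributes `1 - p/2 ≤ exp (-p/2)`. A minorant `f` of `accessProb` is allowed
so that later only low probabilities need be counted. -/
theorem prod_integral_attemptFactor_le {n : ℕ} (D : Measure Choices) [IsProbabilityMeasure D]
    {f : ℕ → ℝ} (hf : ∀ i, f i ≤ accessProb D i) (w : Schedule n) (S : Finset (Fin n)) (t : ℕ) :
    ∏ v, ∫ x, attemptFactor w S t v x ∂D ≤ Real.exp (-contention f w S t / 2) := by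
  classical
  simp only [integral_attemptFactor]
  rw [Finset.prod_ite, Finset.prod_const_one, mul_one]
  unfold contention
  have : -(∑ v ∈ Finset.univ.filter (fun v => w v < t ∧ v ∉ S), f (t - w v)) / 2 =
      ∑ v ∈ Finset.univ.filter (fun v => w v < t ∧ v ∉ S), -(f (t - w v) / 2) := by
    rw [Finset.sum_neg_distrib, ← Finset.sum_div]; ring
  rw [this, Real.exp_sum]
  refine Finset.prod_le_prod (fun v _ => ?_) (fun v _ => ?_)
  · have := accessProb_le_one D (t - w v); linarith
  · have h1 := Real.add_one_le_exp (-(f (t - w v) / 2))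
    have h2 := hf (t - w v)
    linarith

theorem integral_attemptFactor_nonneg {n : ℕ} (D : Measure Choices) [IsProbabilityMeasure D]
    (w : Schedule n) (S : Finset (Fin n)) (t : ℕ) (v : Fin n) :
    1 / 2 ≤ ∫ x, attemptFactor w S t v x ∂D := by
  rw [integral_attemptFactor]
  have := accessProb_le_one D (t - w v)
  split_ifs <;> linarith

theorem integrable_prod_of_choices {n : ℕ} (D : Measure Choices) [IsProbabilityMeasure D]
    {h : Fin n → Choices → ℝ} (hm : ∀ v, Measurable (h v)) (h0 : ∀ v x, 0 ≤ h v x)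
    (h1 : ∀ v x, h v x ≤ 1) : Integrable (fun X => ∏ v, h v (X v)) (jointLaw D n) := by
  refine Integrable.of_bound (C := 1) (Measurable.aestronglyMeasurable ?_) (ae_of_all _ fun X => ?_)
  · exact Finset.measurable_fun_prod _ fun v _ => (hm v).comp (measurable_pi_apply v)
  · rw [Real.norm_of_nonneg (Finset.prod_nonneg fun v _ => h0 v _)]
    exact Finset.prod_le_one (fun v _ => h0 v _) (fun v _ => h1 v _)

theorem measurable_choice_ite (i : ℕ) (a b : ℝ) :
    Measurable fun x : Choices => if x i = true then a else b :=
  Measurable.ite (measurableSet_choice i) measurable_const measurable_const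

theorem measurable_attemptFactor {n : ℕ} (w : Schedule n) (S : Finset (Fin n)) (t : ℕ) (v : Fin n) :
    Measurable (attemptFactor w S t v) := by
  unfold attemptFactor
  by_cases h : w v < t ∧ v ∉ S
  · simp only [h, true_and, not_false_eq_true]
    exact measurable_choice_ite _ _ _
  · have : ∀ x : Choices, ¬(w v < t ∧ v ∉ S ∧ x (t - w v) = true) := fun x hx => h ⟨hx.1, hx.2.1⟩
    simp only [this, if_false]
    exact measurable_const

open Classical in
/-- Probability that exactly one party attempts, when the parties in `S` have left. -/
theorem integral_single_grabber_le {n : ℕ} (D : Measure Choices) [IsProbabilityMeasure D]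
    {f : ℕ → ℝ} (hf : ∀ i, f i ≤ accessProb D i) (w : Schedule n) (S : Finset (Fin n)) (t : ℕ) :
    ∫ X, (if (grabbers w X S t).card = 1 then (1 : ℝ) else 0) ∂(jointLaw D n) ≤
      2 * Real.exp (-contention f w S t / 2) := by
  have hint := integrable_prod_of_choices D (measurable_attemptFactor w S t)
    (fun v x => by unfold attemptFactor; split_ifs <;> norm_num)
    (fun v x => by unfold attemptFactor; split_ifs <;> norm_num)
  -- The indicator of exactly one attempt is dominated by `2 * (1/2) ^ card`, which is a product
  -- over the parties.
  calc _ ≤ ∫ X, 2 * ∏ v, attemptFactor w S t v (X v) ∂(jointLaw D n) := by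
        refine integral_mono ?_ (hint.const_mul 2) fun X => ?_
        · exact ((dependsOn_grabbers w S t).comp
            (fun A => if A.card = 1 then (1 : ℝ) else 0)).integrable _
        · simp only [prod_attemptFactor]
          split_ifs with h
          · rw [h]; norm_num
          · positivity
    _ ≤ _ := by
        rw [integral_const_mul]
        refine mul_le_mul_of_nonneg_left ?_ (by norm_num)
        unfold jointLaw
        rw [integral_fintype_prod_eq_prod (𝕜 := ℝ) (attemptFactor w S t)]
        exact prod_integral_attemptFactor_le D hf w S t

open Classical in
/-- Probability that exactly `u` attempts, when the parties in `S` have left. -/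
theorem integral_single_grabber_eq_le {n : ℕ} (D : Measure Choices) [IsProbabilityMeasure D]
    {f : ℕ → ℝ} (hf : ∀ i, f i ≤ accessProb D i) (w : Schedule n) (S : Finset (Fin n)) (t : ℕ)
    (u : Fin n) :
    ∫ X, (if (grabbers w X S t).card = 1 ∧ u ∈ grabbers w X S t then (1 : ℝ) else 0)
        ∂(jointLaw D n) ≤
      accessProb D (t - w u) * (2 * Real.exp (-contention f w S t / 2)) := by
  -- The factor of `u` vanishes unless `u` attempts; this extracts its attempt probability from the
  -- product.
  set h : Fin n → Choices → ℝ := fun v x =>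
    if v = u then (if x (t - w u) = true then 1 / 2 else 0) else attemptFactor w S t v x with hdef
  have hint := integrable_prod_of_choices D (h := h)
    (fun v => by
      simp only [hdef]
      by_cases hv : v = u
      · simp only [hv, if_true]; exact measurable_choice_ite _ _ _
      · simp only [hv, if_false]; exact measurable_attemptFactor w S t v)
    (fun v x => by simp only [hdef, attemptFactor]; split_ifs <;> norm_num)
    (fun v x => by simp only [hdef, attemptFactor]; split_ifs <;> norm_num)
  have hnn : ∀ v x, 0 ≤ h v x := fun v x => by
    simp only [hdef, attemptFactor]; split_ifs <;> norm_num
  have hp := accessProb_nonneg D (t - w u)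
  calc _ ≤ ∫ X, 2 * ∏ v, h v (X v) ∂(jointLaw D n) := by
        refine integral_mono ?_ (hint.const_mul 2) fun X => ?_
        · exact ((dependsOn_grabbers w S t).comp
            (fun A => if A.card = 1 ∧ u ∈ A then (1 : ℝ) else 0)).integrable _
        · dsimp only
          split_ifs with hX
          · have hu := hX.2
            simp only [grabbers, Finset.mem_filter, Finset.mem_univ, true_and] at hu
            have : ∏ v, h v (X v) = ∏ v, attemptFactor w S t v (X v) := by
              refine Finset.prod_congr rfl fun v _ => ?_
              simp only [hdef]
              split_ifs with hv h2
              · subst hv; simp [attemptFactor, hu]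
              · subst hv; exact absurd hu.2.2 h2
              · rfl
            rw [this, prod_attemptFactor, hX.1]; norm_num
          · exact mul_nonneg (by norm_num) (Finset.prod_nonneg fun v _ => hnn v _)
    _ ≤ _ := by
        rw [integral_const_mul]
        unfold jointLaw
        rw [integral_fintype_prod_eq_prod (𝕜 := ℝ) h]
        have h1 := prod_integral_attemptFactor_le D hf w S t
        have h2 : ∏ v, ∫ x, h v x ∂D ≤
            accessProb D (t - w u) * ∏ v, ∫ x, attemptFactor w S t v x ∂D := by
          rw [← Finset.mul_prod_erase _ _ (Finset.mem_univ u),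
            ← Finset.mul_prod_erase _ (fun v => ∫ x, attemptFactor w S t v x ∂D)
              (Finset.mem_univ u), ← mul_assoc]
          have h3 : ∏ v ∈ Finset.univ.erase u, ∫ x, h v x ∂D =
              ∏ v ∈ Finset.univ.erase u, ∫ x, attemptFactor w S t v x ∂D := by
            refine Finset.prod_congr rfl fun v hv => ?_
            simp only [hdef, Finset.ne_of_mem_erase hv, if_false]
          rw [h3]
          refine mul_le_mul_of_nonneg_right ?_ (Finset.prod_nonneg fun v _ =>
            le_trans (by norm_num) (integral_attemptFactor_nonneg D w S t v))
          -- The factor `1/2` is absorbed by the original factor of `u`, whose integral is at least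
          -- `1/2`.
          have h4 : ∫ x, h u x ∂D = accessProb D (t - w u) / 2 := by
            simp only [hdef, if_true]
            rw [integral_choice]; ring
          rw [h4]
          have := integral_attemptFactor_nonneg D w S t u
          nlinarith
        have h5 := mul_le_mul_of_nonneg_left h1 hp
        nlinarith

end OneSlot


/-! ### The evolution over slots: calm successes and lost contention. -/

section SlotProcess

variable {n : ℕ}

open Classical in
/-- Given the past, the slot `t + 1` is fresh: a bound on the expectation of `K S` that holds for
each fixed set `S` of parties that have left holds for the random set as well. -/
theorem integral_mul_slot_le {D : Measure Choices} [IsProbabilityMeasure D] (hD : IsMemoryless D)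
    (w : Schedule n) (t : ℕ) {φ : (Fin n → Choices) → ℝ}
    (hφ : DependsOnChoices (pastChoices w t) φ) (hφ0 : ∀ X, 0 ≤ φ X)
    (K : Finset (Fin n) → Finset (Fin n) → ℝ) {r : ℝ}
    (hK : ∀ S, ∫ X, K S (grabbers w X S (t + 1)) ∂(jointLaw D n) ≤ r) :
    ∫ X, φ X * K (succeeded w X t) (grabbers w X (succeeded w X t) (t + 1)) ∂(jointLaw D n) ≤
      r * ∫ X, φ X ∂(jointLaw D n) := by
  -- Splitting by the value of the departed set makes it deterministic in each summand, so that past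
  -- and current slot become independent.
  set ψ : Finset (Fin n) → (Fin n → Choices) → ℝ :=
    fun S X => φ X * if succeeded w X t = S then 1 else 0 with hψ
  have hdep : ∀ S, DependsOnChoices (pastChoices w t) (ψ S) := fun S =>
    hφ.comp₂ (dependsOn_succeeded w t) fun a A => a * if A = S then 1 else 0
  have hslot : ∀ S, DependsOnChoices (slotChoices w (t + 1))
      fun X => K S (grabbers w X S (t + 1)) := fun S => (dependsOn_grabbers w S (t + 1)).comp (K S)
  have hsum : ∀ X, φ X = ∑ S, ψ S X := fun X => by simp [hψ]
  have h1 : ∀ X, φ X * K (succeeded w X t) (grabbers w X (succeeded w X t) (t + 1)) =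
      ∑ S, ψ S X * K S (grabbers w X S (t + 1)) := by
    intro X
    rw [Finset.sum_eq_single (succeeded w X t)]
    · simp [hψ]
    · intro S _ hS; simp [hψ, hS.symm]
    · simp
  simp only [h1]
  rw [integral_finsetSum]
  · conv_rhs => rw [show φ = fun X => ∑ S, ψ S X from funext hsum]
    rw [integral_finsetSum _ fun S _ => (hdep S).integrable _, Finset.mul_sum]
    refine Finset.sum_le_sum fun S _ => ?_
    rw [(hdep S).integral_mul hD (hslot S) (disjoint_past_slot w t), mul_comm]
    refine mul_le_mul_of_nonneg_right (hK S) (integral_nonneg fun X => ?_)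
    simp only [hψ]
    exact mul_nonneg (hφ0 X) (by split_ifs <;> norm_num)
  · intro S _
    have := ((hdep S).mono ((pastChoices_mono w t.le_succ))).comp₂
      ((hslot S).mono (slotChoices_subset_past w _)) (fun a b => a * b)
    exact this.integrable _

open Classical in
/-- The indicator of a success in slot `t + 1` at a moment when the contention is at least `c`. -/
noncomputable def calmSuccess (w : Schedule n) (f : ℕ → ℝ) (c : ℝ) (t : ℕ)
    (X : Fin n → Choices) : ℝ :=
  if (grabbers w X (succeeded w X t) (t + 1)).card = 1 ∧
    c ≤ contention f w (succeeded w X t) (t + 1) then 1 else 0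

theorem dependsOn_next (w : Schedule n) (t : ℕ) :
    DependsOnChoices (pastChoices w (t + 1))
      fun X => (succeeded w X t, grabbers w X (succeeded w X t) (t + 1)) := by
  intro X X' h
  have h1 : succeeded w X t = succeeded w X' t :=
    (dependsOn_succeeded w t).mono (pastChoices_mono w t.le_succ) X X' h
  have h2 := fun S => (dependsOn_grabbers w S (t + 1)).mono (slotChoices_subset_past w _) X X' h
  simp only at h2
  simp only [h1, h2]

theorem dependsOn_calmSuccess (w : Schedule n) (f : ℕ → ℝ) (c : ℝ) (t : ℕ) :
    DependsOnChoices (pastChoices w (t + 1)) (calmSuccess w f c t) := by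
  classical
  exact (dependsOn_next w t).comp fun A => if A.2.card = 1 ∧ c ≤ contention f w A.1 (t + 1)
    then (1 : ℝ) else 0

/-- An integrated form of a conditional bound: given any past, a calm success has probability at
most `2 exp (-c/2)`. The calmness condition is built into the indicator, so there is no conditioning
on the contention staying high. -/
theorem integral_mul_calmSuccess_le {D : Measure Choices} [IsProbabilityMeasure D]
    (hD : IsMemoryless D) {f : ℕ → ℝ} (hf : ∀ i, f i ≤ accessProb D i) (w : Schedule n) (c : ℝ)
    (t : ℕ) {φ : (Fin n → Choices) → ℝ} (hφ : DependsOnChoices (pastChoices w t) φ)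
    (hφ0 : ∀ X, 0 ≤ φ X) :
    ∫ X, φ X * calmSuccess w f c t X ∂(jointLaw D n) ≤
      2 * Real.exp (-c / 2) * ∫ X, φ X ∂(jointLaw D n) := by
  classical
  refine integral_mul_slot_le hD w t hφ hφ0
    (fun S A => if A.card = 1 ∧ c ≤ contention f w S (t + 1) then 1 else 0) fun S => ?_
  by_cases hc : c ≤ contention f w S (t + 1)
  · simp only [hc, and_true]
    refine (integral_single_grabber_le D hf w S (t + 1)).trans ?_
    gcongr
  · simp only [hc, and_false, if_false, integral_zero]
    positivity

open Classical in
-- The factor `accessProb` is kept so that the union over slots costs the sum of `u`'s attempt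
-- probabilities and not the number of slots.
theorem prob_calm_win_le {D : Measure Choices} [IsProbabilityMeasure D]
    (hD : IsMemoryless D) {f : ℕ → ℝ} (hf : ∀ i, f i ≤ accessProb D i) (w : Schedule n) (c : ℝ)
    (t : ℕ) (u : Fin n) :
    (jointLaw D n).real {X | ((grabbers w X (succeeded w X t) (t + 1)).card = 1 ∧
        u ∈ grabbers w X (succeeded w X t) (t + 1)) ∧
        c ≤ contention f w (succeeded w X t) (t + 1)} ≤
      accessProb D (t + 1 - w u) * (2 * Real.exp (-c / 2)) := by
  have h := integral_mul_slot_le hD w t (φ := fun _ => 1) (fun _ _ _ => rfl) (fun _ => zero_le_one)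
    (fun S A => if (A.card = 1 ∧ u ∈ A) ∧ c ≤ contention f w S (t + 1) then 1 else 0)
    (r := accessProb D (t + 1 - w u) * (2 * Real.exp (-c / 2))) fun S => by
      by_cases hc : c ≤ contention f w S (t + 1)
      · simp only [hc, and_true]
        refine (integral_single_grabber_eq_le D hf w S (t + 1) u).trans ?_
        have := accessProb_nonneg D (t + 1 - w u)
        gcongr
      · simp only [hc, and_false, if_false, integral_zero]
        exact mul_nonneg (accessProb_nonneg _ _) (by positivity)
  have hm : MeasurableSet {X : Fin n → Choices |
      ((grabbers w X (succeeded w X t) (t + 1)).card = 1 ∧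
        u ∈ grabbers w X (succeeded w X t) (t + 1)) ∧
        c ≤ contention f w (succeeded w X t) (t + 1)} :=
    ((dependsOn_next w t).comp fun A => (A.2.card = 1 ∧ u ∈ A.2) ∧
      c ≤ contention f w A.1 (t + 1)).measurable.setOf
  rw [← integral_indicator_one hm]
  refine le_trans (le_of_eq ?_) (h.trans (by simp))
  congr 1
  funext X
  simp [Set.indicator_apply]

theorem calmSuccess_eq_zero_or_one (w : Schedule n) (f : ℕ → ℝ) (c : ℝ) (t : ℕ)
    (X : Fin n → Choices) : calmSuccess w f c t X = 0 ∨ calmSuccess w f c t X = 1 := by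
  unfold calmSuccess; split_ifs <;> simp

theorem dependsOn_sum_calmSuccess (w : Schedule n) (f : ℕ → ℝ) (c : ℝ) (a : ℕ → ℝ) (m : ℕ) :
    DependsOnChoices (pastChoices w m)
      fun X => ∑ s ∈ Finset.range m, a s * calmSuccess w f c s X := by
  intro X X' h
  refine Finset.sum_congr rfl fun s hs => ?_
  rw [(dependsOn_calmSuccess w f c s).mono
    (pastChoices_mono w (Nat.succ_le_of_lt (Finset.mem_range.1 hs))) X X' h]

/-- Exponential moments of weighted numbers of calm successes. -/
theorem integral_exp_sum_calmSuccess_le {D : Measure Choices} [IsProbabilityMeasure D]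
    (hD : IsMemoryless D) {f : ℕ → ℝ} (hf : ∀ i, f i ≤ accessProb D i) (w : Schedule n) (c : ℝ)
    (a : ℕ → ℝ) (ha : ∀ s, 0 ≤ a s) (m : ℕ) :
    ∫ X, Real.exp (∑ s ∈ Finset.range m, a s * calmSuccess w f c s X) ∂(jointLaw D n) ≤
      Real.exp (2 * Real.exp (-c / 2) * ∑ s ∈ Finset.range m, (Real.exp (a s) - 1)) := by
  set r := 2 * Real.exp (-c / 2) with hr
  induction m with
  | zero => simp
  | succ m ih =>
    set φ : (Fin n → Choices) → ℝ :=
      fun X => Real.exp (∑ s ∈ Finset.range m, a s * calmSuccess w f c s X) with hφ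
    have hdep : DependsOnChoices (pastChoices w m) φ :=
      (dependsOn_sum_calmSuccess w f c a m).comp Real.exp
    have h1 := integral_mul_calmSuccess_le hD hf w c m hdep fun X => (Real.exp_pos _).le
    -- For `Z` in `{0, 1}`, `exp (a Z) = 1 + (exp a - 1) Z`.
    have h2 : ∀ X, Real.exp (∑ s ∈ Finset.range (m + 1), a s * calmSuccess w f c s X) =
        φ X + (Real.exp (a m) - 1) * (φ X * calmSuccess w f c m X) := by
      intro X
      rw [Finset.sum_range_succ, Real.exp_add]
      rcases calmSuccess_eq_zero_or_one w f c m X with h | h <;> rw [h] <;> simp [hφ]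
      ring
    have h3 : Integrable (fun X => φ X * calmSuccess w f c m X) (jointLaw D n) :=
      ((hdep.mono (pastChoices_mono w m.le_succ)).comp₂ (dependsOn_calmSuccess w f c m)
        (fun a b : ℝ => a * b)).integrable _
    simp only [h2]
    rw [integral_add (hdep.integrable _) (h3.const_mul _), integral_const_mul,
      Finset.sum_range_succ, mul_add, Real.exp_add]
    have h4 : 0 ≤ Real.exp (a m) - 1 := by
      have := Real.add_one_le_exp (a m); have := ha m; linarith
    have h5 : 0 ≤ ∫ X, φ X ∂(jointLaw D n) := integral_nonneg fun X => (Real.exp_pos _).le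
    have h6 := Real.add_one_le_exp (r * (Real.exp (a m) - 1))
    calc _ ≤ (∫ X, φ X ∂(jointLaw D n)) * (r * (Real.exp (a m) - 1) + 1) := by
          have := mul_le_mul_of_nonneg_left h1 h4
          nlinarith
      _ ≤ (∫ X, φ X ∂(jointLaw D n)) * Real.exp (r * (Real.exp (a m) - 1)) :=
          mul_le_mul_of_nonneg_left h6 h5
      _ ≤ _ := mul_le_mul_of_nonneg_right ih (Real.exp_pos _).le

/-- Markov's inequality for the exponential moment at parameter 1, with `exp a - 1 ≤ 2 a` for
weights in `[0, 1]`. -/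
theorem prob_sum_calmSuccess_ge_le {D : Measure Choices} [IsProbabilityMeasure D]
    (hD : IsMemoryless D) {f : ℕ → ℝ} (hf : ∀ i, f i ≤ accessProb D i) (w : Schedule n) (c : ℝ)
    (a : ℕ → ℝ) (ha : ∀ s, 0 ≤ a s) (ha1 : ∀ s, a s ≤ 1) (m : ℕ) (x : ℝ) :
    (jointLaw D n).real {X | x ≤ ∑ s ∈ Finset.range m, a s * calmSuccess w f c s X} ≤
      Real.exp (-x + 2 * (2 * Real.exp (-c / 2)) * ∑ s ∈ Finset.range m, a s) := by
  have hdep := dependsOn_sum_calmSuccess w f c a m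
  have h0 : Integrable (fun X => Real.exp (1 * ∑ s ∈ Finset.range m, a s * calmSuccess w f c s X))
      (jointLaw D n) := (hdep.comp fun y : ℝ => Real.exp (1 * y)).integrable _
  have h1 := measure_ge_le_exp_mul_mgf (μ := jointLaw D n) (t := 1)
    (X := fun X => ∑ s ∈ Finset.range m, a s * calmSuccess w f c s X) x zero_le_one
    h0
  refine h1.trans ?_
  rw [Real.exp_add]
  simp only [mgf, one_mul, neg_mul]
  refine mul_le_mul_of_nonneg_left ((integral_exp_sum_calmSuccess_le hD hf w c a ha m).trans ?_)
    (Real.exp_pos _).le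
  refine Real.exp_le_exp.2 ?_
  rw [mul_comm 2 (2 * Real.exp (-c / 2)), mul_assoc (2 * Real.exp (-c / 2)),
    Finset.mul_sum (f := a)]
  refine mul_le_mul_of_nonneg_left (Finset.sum_le_sum fun s _ => ?_) (by positivity)
  have h2 := Real.abs_exp_sub_one_le (x := a s) (by rw [abs_of_nonneg (ha s)]; exact ha1 s)
  rw [abs_of_nonneg (ha s)] at h2
  exact (le_abs_self _).trans h2

/-- A party that has left succeeded in some earlier slot. -/
theorem exists_slot_of_mem_succeeded {w : Schedule n} {X : Fin n → Choices} {u : Fin n} {T : ℕ}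
    (h : u ∈ succeeded w X T) :
    ∃ t < T, (grabbers w X (succeeded w X t) (t + 1)).card = 1 ∧
      u ∈ grabbers w X (succeeded w X t) (t + 1) := by
  induction T with
  | zero => simp [succeeded] at h
  | succ T ih =>
    by_cases hT : u ∈ succeeded w X T
    · obtain ⟨t, ht, h'⟩ := ih hT
      exact ⟨t, by omega, h'⟩
    · simp only [succeeded] at h
      split_ifs at h with hc
      · exact ⟨T, by omega, hc, (Finset.mem_union.1 h).resolve_left hT⟩
      · exact absurd h hT

open Classical in
/-- The indicator of a success in slot `t + 1`. -/
noncomputable def slotSuccess (w : Schedule n) (X : Fin n → Choices) (t : ℕ) : ℝ :=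
  if (grabbers w X (succeeded w X t) (t + 1)).card = 1 then 1 else 0

theorem contention_add_lost (f : ℕ → ℝ) (w : Schedule n) (S : Finset (Fin n)) (t : ℕ) :
    contention f w S t + ∑ v ∈ S, (if w v < t then f (t - w v) else 0) = contention f w ∅ t := by
  classical
  unfold contention
  rw [← Finset.sum_filter, ← Finset.sum_union]
  · refine Finset.sum_congr ?_ fun _ _ => rfl
    ext v
    simp only [Finset.mem_union, Finset.mem_filter, Finset.mem_univ, true_and, Finset.notMem_empty,
      not_false_eq_true, and_true]
    tauto
  · rw [Finset.disjoint_left]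
    intro v h1 h2
    exact (Finset.mem_filter.1 h1).2.2 (Finset.mem_filter.1 h2).1

/-- The contention lost at time `t + 1` to the parties that left at times `≤ m`. -/
theorem lost_le {f g : ℕ → ℝ} (hg : Antitone g) (hfg : ∀ i, 2 ≤ i → f i ≤ g i)
    (w : Schedule n) (X : Fin n → Choices) (t : ℕ) {m : ℕ} (hm : m ≤ t) :
    ∑ v ∈ succeeded w X m, (if w v < t + 1 then f (t + 1 - w v) else 0) ≤
      ∑ s ∈ Finset.range m, g (t - s) * slotSuccess w X s := by
  induction m with
  | zero => simp [succeeded]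
  | succ m ih =>
    rw [Finset.sum_range_succ]
    have ih := ih (by omega)
    simp only [succeeded]
    rw [show slotSuccess w X m = if (grabbers w X (succeeded w X m) (m + 1)).card = 1 then 1 else 0
      from rfl]
    split_ifs with hc
    · obtain ⟨v, hv⟩ := Finset.card_eq_one.1 hc
      have hmem : v ∈ grabbers w X (succeeded w X m) (m + 1) := by rw [hv]; simp
      simp only [grabbers, Finset.mem_filter, Finset.mem_univ, true_and] at hmem
      rw [hv, Finset.sum_union (by simpa using hmem.2.1), Finset.sum_singleton]
      refine add_le_add ih ?_
      rw [if_pos (by omega), mul_one]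
      -- A party leaving in slot `m + 1 ≤ t` woke up by time `m`, so its age at `t + 1` is at least
      -- `t + 1 - m ≥ 2`. Hence `f 1`, which `g` need not dominate, is never charged.
      exact (hfg _ (by omega)).trans (hg (by omega))
    · simpa using ih

/-- If the contention without departures is at least `2c` throughout, and the weighted numbers of
calm successes remain small, then the contention is at least `c` throughout. -/
theorem contention_ge_of_calm {f g : ℕ → ℝ} (hg : Antitone g) (hfg : ∀ i, 2 ≤ i → f i ≤ g i)
    (w : Schedule n) (X : Fin n → Choices) {T : ℕ} {c : ℝ}
    (hY : ∀ t < T, 2 * c ≤ contention f w ∅ (t + 1))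
    (hW : ∀ t < T, ∑ s ∈ Finset.range t, g (t - s) * calmSuccess w f c s X < c) :
    ∀ t < T, c ≤ contention f w (succeeded w X t) (t + 1) := by
  intro t
  induction t using Nat.strong_induction_on with
  | _ t ih =>
    intro ht
    have h1 := contention_add_lost f w (succeeded w X t) (t + 1)
    have h2 := lost_le hg hfg w X t le_rfl
    -- By induction the contention was at least `c` in all earlier slots, so every earlier success
    -- was calm.
    have h3 : ∑ s ∈ Finset.range t, g (t - s) * slotSuccess w X s =
        ∑ s ∈ Finset.range t, g (t - s) * calmSuccess w f c s X := by
      refine Finset.sum_congr rfl fun s hs => ?_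
      have hs := Finset.mem_range.1 hs
      have := ih s hs (by omega)
      simp [slotSuccess, calmSuccess, this]
    have h4 := hW t ht
    have h5 := hY t ht
    linarith

/-- A party that wakes up at time `0` is unlikely to succeed while the contention is high and
consists of parties whose attempt probability is small. -/
theorem prob_mem_succeeded_le {D : Measure Choices} [IsProbabilityMeasure D]
    (hD : IsMemoryless D) {f g : ℕ → ℝ} (hf : ∀ i, f i ≤ accessProb D i) (hg : Antitone g)
    (hfg : ∀ i, 2 ≤ i → f i ≤ g i) (hg0 : ∀ i, 0 ≤ g i) (w : Schedule n) {T : ℕ} {c θ : ℝ}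
    (hθ : 0 < θ) (hθg : ∀ i, θ * g i ≤ 1)
    (hY : ∀ t < T, 2 * c ≤ contention f w ∅ (t + 1)) {u : Fin n} (hu : w u = 0) :
    (jointLaw D n).real {X | u ∈ succeeded w X T} ≤
      T * Real.exp (-(θ * c) + 2 * (2 * Real.exp (-c / 2)) * (θ * ∑ a ∈ Finset.Icc 1 T, g a)) +
      2 * Real.exp (-c / 2) * ∑ t ∈ Finset.Icc 1 T, accessProb D t := by
  set bad : ℕ → Set (Fin n → Choices) := fun t =>
    {X | θ * c ≤ ∑ s ∈ Finset.range t, (θ * g (t - s)) * calmSuccess w f c s X} with hbad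
  set win : ℕ → Set (Fin n → Choices) := fun t =>
    {X | ((grabbers w X (succeeded w X t) (t + 1)).card = 1 ∧
        u ∈ grabbers w X (succeeded w X t) (t + 1)) ∧
        c ≤ contention f w (succeeded w X t) (t + 1)} with hwin
  -- Either the calm losses become too heavy at some time, or the contention stays high and `u` wins
  -- a calm slot.
  have hsub : {X | u ∈ succeeded w X T} ⊆
      (⋃ t ∈ Finset.range T, bad t) ∪ ⋃ t ∈ Finset.range T, win t := by
    intro X hX
    by_cases hb : ∃ t < T, X ∈ bad t
    · obtain ⟨t, ht, h⟩ := hb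
      exact Or.inl (Set.mem_biUnion (Finset.mem_coe.2 (Finset.mem_range.2 ht)) h)
    · push Not at hb
      obtain ⟨t, ht, h⟩ := exists_slot_of_mem_succeeded hX
      refine Or.inr (Set.mem_biUnion (Finset.mem_coe.2 (Finset.mem_range.2 ht)) ⟨h, ?_⟩)
      refine contention_ge_of_calm hg hfg w X hY (fun t ht => ?_) t ht
      have h1 := hb t ht
      simp only [hbad, Set.mem_ofPred_eq, not_le, mul_assoc, ← Finset.mul_sum] at h1
      exact lt_of_mul_lt_mul_left h1 hθ.le
  have hIcc : ∀ F : ℕ → ℝ, ∑ t ∈ Finset.range T, F (t + 1) = ∑ t ∈ Finset.Icc 1 T, F t := by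
    intro F
    rw [Finset.range_eq_Ico, Finset.sum_Ico_add' F 0 T 1]
    rfl
  refine (measureReal_mono hsub).trans ((measureReal_union_le _ _).trans (add_le_add ?_ ?_))
  · refine (measureReal_biUnion_finset_le _ _).trans ?_
    refine (Finset.sum_le_card_nsmul _ _ _ fun t ht => ?_).trans (by
      rw [Finset.card_range, nsmul_eq_mul])
    refine (prob_sum_calmSuccess_ge_le hD hf w c (fun s => θ * g (t - s))
      (fun s => mul_nonneg hθ.le (hg0 _)) (fun s => hθg _) t (θ * c)).trans ?_
    refine Real.exp_le_exp.2 (add_le_add_right ?_ _)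
    refine mul_le_mul_of_nonneg_left ?_ (by positivity)
    rw [← Finset.mul_sum]
    refine mul_le_mul_of_nonneg_left ?_ hθ.le
    rw [← hIcc]
    have hr : ∑ s ∈ Finset.range t, g (t - s) = ∑ s ∈ Finset.range t, g (s + 1) := by
      rw [← Finset.sum_range_reflect]
      refine Finset.sum_congr rfl fun s hs => ?_
      have := Finset.mem_range.1 hs
      congr 1; omega
    rw [hr]
    exact Finset.sum_le_sum_of_subset_of_nonneg
      (Finset.range_mono (Finset.mem_range.1 ht).le) fun _ _ _ => hg0 _
  · refine (measureReal_biUnion_finset_le _ _).trans ?_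
    rw [Finset.mul_sum, ← hIcc fun t => 2 * Real.exp (-c / 2) * accessProb D t]
    refine Finset.sum_le_sum fun t _ => ?_
    refine (prob_calm_win_le hD hf w c t u).trans (le_of_eq ?_)
    rw [hu]; simp only [Nat.sub_zero]; ring

/-- If the contention without departures is at least `c` throughout, then it is unlikely that any
party succeeds. -/
theorem prob_mem_succeeded_le_of_contention {D : Measure Choices} [IsProbabilityMeasure D]
    {f : ℕ → ℝ} (hf : ∀ i, f i ≤ accessProb D i) (w : Schedule n) {T : ℕ} {c : ℝ}
    (hY : ∀ t < T, c ≤ contention f w ∅ (t + 1)) (u : Fin n) :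
    (jointLaw D n).real {X | u ∈ succeeded w X T} ≤ T * (2 * Real.exp (-c / 2)) := by
  classical
  have hsub : {X | u ∈ succeeded w X T} ⊆
      ⋃ t ∈ Finset.range T, {X | (grabbers w X ∅ (t + 1)).card = 1} := by
    intro X hX
    -- Up to the first success nobody has left, so only the contention with `∅` matters and no
    -- dependence between slots has to be handled.
    have hne : ∃ t, succeeded w X t ≠ ∅ := ⟨T, Finset.ne_empty_of_mem hX⟩
    have h0 := Nat.find_spec hne
    have hpos : Nat.find hne ≠ 0 := by
      intro h; rw [h] at h0; exact h0 rfl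
    obtain ⟨t, ht⟩ := Nat.exists_eq_succ_of_ne_zero hpos
    have htT : t < T := by
      have := Nat.find_min' hne (Finset.ne_empty_of_mem hX); omega
    have h1 : succeeded w X t = ∅ := by
      by_contra h; exact Nat.find_min hne (by omega) h
    refine Set.mem_biUnion (Finset.mem_coe.2 (Finset.mem_range.2 htT)) ?_
    by_contra h2
    rw [ht] at h0
    simp only [succeeded, h1] at h0
    exact h0 (if_neg h2)
  refine (measureReal_mono hsub (measure_ne_top _ _)).trans
    ((measureReal_biUnion_finset_le _ _).trans ?_)
  refine (Finset.sum_le_card_nsmul _ _ _ fun t ht => ?_).trans (by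
      rw [Finset.card_range, nsmul_eq_mul])
  have hm : MeasurableSet {X : Fin n → Choices | (grabbers w X ∅ (t + 1)).card = 1} :=
    ((dependsOn_grabbers w ∅ (t + 1)).comp fun A => A.card = 1).measurable.setOf
  rw [← integral_indicator_one hm]
  refine le_trans (le_of_eq ?_) ((integral_single_grabber_le D hf w ∅ (t + 1)).trans ?_)
  · congr 1; funext X; simp [Set.indicator_apply]
  · have := hY t (Finset.mem_range.1 ht)
    gcongr

end SlotProcess


/-! ### Arrival times with high contention, by averaging. -/

section Schedules

/-- By convexity the graph lies below its chord on `[0, 1]`, whose descent rate `1 - 1/e` exceeds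
`3/5`. -/
theorem exp_neg_le_of_mem_Icc {x : ℝ} (h0 : 0 ≤ x) (h1 : x ≤ 1) :
    Real.exp (-x) ≤ 1 - 3 / 5 * x := by
  have h := convexOn_exp.2 (Set.mem_univ (0 : ℝ)) (Set.mem_univ (-1 : ℝ))
    (sub_nonneg.2 h1) h0 (by ring)
  have h2 := Real.exp_neg_one_lt_d9
  simp only [smul_eq_mul, mul_zero, zero_add, mul_neg, mul_one, Real.exp_zero] at h
  nlinarith

/-- The value of the weights `h` at time `t` for an arrival at time `a`. -/
noncomputable def arrivalWeight (h : ℕ → ℝ) (t a : ℕ) : ℝ := if a < t then h (t - a) else 0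

/-- As the arrival slot runs over `[0, t)`, each age `1, …, t` occurs exactly once at time `t`. -/
theorem sum_Icc_le_sum_arrivalWeight {h : ℕ → ℝ} (h0 : ∀ i, 0 ≤ h i) {k t T : ℕ} (hk : k ≤ t)
    (ht : t ≤ T) : ∑ i ∈ Finset.Icc 1 k, h i ≤ ∑ a : Fin T, arrivalWeight h t a := by
  rw [Fin.sum_univ_eq_sum_range (fun a => arrivalWeight h t a) T]
  have h1 : ∑ a ∈ Finset.range t, arrivalWeight h t a = ∑ i ∈ Finset.Icc 1 t, h i := by
    rw [← Finset.sum_range_reflect]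
    have : ∑ i ∈ Finset.Icc 1 t, h i = ∑ j ∈ Finset.range t, h (j + 1) := by
      rw [Finset.range_eq_Ico, Finset.sum_Ico_add' h 0 t 1]; rfl
    rw [this]
    refine Finset.sum_congr rfl fun j hj => ?_
    have := Finset.mem_range.1 hj
    rw [arrivalWeight, if_pos (by omega)]
    congr 1; omega
  calc _ ≤ ∑ i ∈ Finset.Icc 1 t, h i :=
        Finset.sum_le_sum_of_subset_of_nonneg (Finset.Icc_subset_Icc_right hk) fun _ _ _ => h0 _
    _ = ∑ a ∈ Finset.range t, arrivalWeight h t a := h1.symm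
    _ ≤ _ := Finset.sum_le_sum_of_subset_of_nonneg (Finset.range_mono ht) fun _ _ _ => by
        unfold arrivalWeight; split_ifs <;> simp [h0]

/-- Averaging over uniform arrival times: some choice of `N` arrival times keeps the total weight
above `m` at all times in `(k, T]`. -/
theorem exists_arrivals {h : ℕ → ℝ} (h0 : ∀ i, 0 ≤ h i) {ε : ℝ} (hε : 0 < ε)
    (h1 : ∀ i, h i ≤ ε) {N k T : ℕ} (hT : 0 < T) {m : ℝ}
    (hm : T * Real.exp (-(3 / 5 * (N * (∑ i ∈ Finset.Icc 1 k, h i) / (T * ε)))) <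
      Real.exp (-(m / ε))) :
    ∃ a : Fin N → Fin T, ∀ t, k < t → t ≤ T → m ≤ ∑ v, arrivalWeight h t (a v) := by
  set F := ∑ i ∈ Finset.Icc 1 k, h i with hF
  have hT' : (0 : ℝ) < T := by exact_mod_cast hT
  by_contra! hcon
  have haw : ∀ t a, 0 ≤ arrivalWeight h t a ∧ arrivalWeight h t a ≤ ε := by
    intro t a; unfold arrivalWeight
    split_ifs
    · exact ⟨h0 _, h1 _⟩
    · exact ⟨le_rfl, hε.le⟩
  have hone : ∀ t, k < t → t ≤ T → ∑ a : Fin T, Real.exp (-(arrivalWeight h t a / ε)) ≤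
      T * Real.exp (-(3 / 5 * (F / (T * ε)))) := by
    intro t hkt htT
    calc ∑ a : Fin T, Real.exp (-(arrivalWeight h t a / ε))
        ≤ ∑ a : Fin T, (1 - 3 / 5 * (arrivalWeight h t a / ε)) := Finset.sum_le_sum fun a _ =>
          exp_neg_le_of_mem_Icc (div_nonneg (haw t a).1 hε.le) ((div_le_one hε).2 (haw t a).2)
      _ = T - 3 / 5 * ((∑ a : Fin T, arrivalWeight h t a) / ε) := by
          rw [Finset.sum_sub_distrib, ← Finset.mul_sum, ← Finset.sum_div]; simp
      _ ≤ T - 3 / 5 * (F / ε) := by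
          have := sum_Icc_le_sum_arrivalWeight h0 hkt.le htT
          gcongr
      _ = T * (1 + -(3 / 5 * (F / (T * ε)))) := by field_simp; ring
      _ ≤ _ := by
          refine mul_le_mul_of_nonneg_left ?_ hT'.le
          have := Real.add_one_le_exp (-(3 / 5 * (F / (T * ε))))
          linarith
  have hsum : ∀ t, k < t → t ≤ T →
      ∑ a : Fin N → Fin T, Real.exp (-((∑ v, arrivalWeight h t (a v)) / ε)) ≤
      (T : ℝ) ^ N * Real.exp (-(3 / 5 * (N * F / (T * ε)))) := by
    intro t hkt htT
    have h2 : ∀ a : Fin N → Fin T, Real.exp (-((∑ v, arrivalWeight h t (a v)) / ε)) =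
        ∏ v, Real.exp (-(arrivalWeight h t (a v) / ε)) := by
      intro a
      rw [Finset.sum_div, ← Finset.sum_neg_distrib, Real.exp_sum]
    simp only [h2]
    have h4 := Finset.prod_univ_sum (fun _ : Fin N => (Finset.univ : Finset (Fin T)))
      (fun _ (x : Fin T) => Real.exp (-(arrivalWeight h t x / ε)))
    rw [Fintype.piFinset_univ] at h4
    rw [← h4, Finset.prod_const, Finset.card_univ, Fintype.card_fin]
    refine (pow_le_pow_left₀ (Finset.sum_nonneg fun _ _ => (Real.exp_pos _).le)
      (hone t hkt htT) N).trans (le_of_eq ?_)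
    rw [mul_pow, ← Real.exp_nat_mul]
    congr 2
    ring
  -- If every arrival vector fails at some time, each one contributes at least `exp (-m/ε)` to the
  -- sum over all vectors and times; the bounds for fixed times make that sum smaller.
  have htot : (T : ℝ) ^ N * Real.exp (-(m / ε)) ≤
      ∑ a : Fin N → Fin T, ∑ t ∈ Finset.Ioc k T,
        Real.exp (-((∑ v, arrivalWeight h t (a v)) / ε)) := by
    have h3 : ∑ _a : Fin N → Fin T, Real.exp (-(m / ε)) = (T : ℝ) ^ N * Real.exp (-(m / ε)) := by
      simp
    rw [← h3]
    refine Finset.sum_le_sum fun a _ => ?_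
    obtain ⟨t, hkt, htT, hlt⟩ := hcon a
    refine le_trans ?_ (Finset.single_le_sum (f := fun t =>
      Real.exp (-((∑ v, arrivalWeight h t (a v)) / ε))) (fun _ _ => (Real.exp_pos _).le)
      (Finset.mem_Ioc.2 ⟨hkt, htT⟩))
    refine Real.exp_le_exp.2 (neg_le_neg ?_)
    gcongr
  rw [Finset.sum_comm] at htot
  have hle : ∑ t ∈ Finset.Ioc k T, ∑ a : Fin N → Fin T,
      Real.exp (-((∑ v, arrivalWeight h t (a v)) / ε)) ≤
      T * ((T : ℝ) ^ N * Real.exp (-(3 / 5 * (N * F / (T * ε))))) := by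
    refine (Finset.sum_le_card_nsmul _ _ _ fun t ht =>
      hsum t (Finset.mem_Ioc.1 ht).1 (Finset.mem_Ioc.1 ht).2).trans ?_
    rw [nsmul_eq_mul, Nat.card_Ioc]
    refine mul_le_mul_of_nonneg_right ?_ (by positivity)
    exact_mod_cast Nat.sub_le _ _
  have hpow : (0 : ℝ) < (T : ℝ) ^ N := by positivity
  have := htot.trans hle
  nlinarith [mul_lt_mul_of_pos_left hm hpow]

/-- The schedule made of `N` given arrivals, `b` arrivals in each slot before `k`, and one more
party at time `0`; the other parties sleep past `T`. -/
theorem exists_schedule {f h : ℕ → ℝ} (hf0 : ∀ i, 0 ≤ f i) (hhf : ∀ i, h i ≤ f i)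
    {n N k b T : ℕ} (hn : N + b * k + 1 ≤ n) {m : ℝ} (hm : m ≤ b * f 1) (a : Fin N → Fin T)
    (ha : ∀ t, k < t → t ≤ T → m ≤ ∑ v, arrivalWeight h t (a v)) :
    ∃ (w : Schedule n) (u : Fin n), w u = 0 ∧
      (Finset.univ.filter fun v => w v ≤ T).card ≤ N + b * k + 1 ∧
      ∀ t < T, m ≤ contention f w ∅ (t + 1) := by
  classical
  -- Division by `b` wakes a block of `b` parties at each time `t < k`; they all have age 1 in slot
  -- `t + 1`, where they contribute `b * f 1`.
  set w : Schedule n := fun v =>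
    if hv : (v : ℕ) < N then (a ⟨v, hv⟩ : ℕ)
    else if (v : ℕ) < N + b * k then ((v : ℕ) - N) / b
    else if (v : ℕ) = N + b * k then 0 else T + 1 with hw
  refine ⟨w, ⟨N + b * k, by omega⟩, ?_, ?_, ?_⟩
  · simp only [hw]
    rw [dif_neg (by omega), if_neg (by omega), if_pos trivial]
  · have : (Finset.univ.filter fun v => w v ≤ T).card ≤ (Finset.range (N + b * k + 1)).card := by
      refine Finset.card_le_card_of_injOn (fun v : Fin n => (v : ℕ)) ?_ Fin.val_injective.injOn
      intro v hv
      have hv := (Finset.mem_filter.1 (Finset.mem_coe.1 hv)).2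
      simp only [hw] at hv
      refine Finset.mem_coe.2 (Finset.mem_range.2 ?_)
      change (v : ℕ) < N + b * k + 1
      split_ifs at hv <;> omega
    simpa using this
  · intro t ht
    have hcont : contention f w ∅ (t + 1) = ∑ v, arrivalWeight f (t + 1) (w v) := by
      simp only [contention, Finset.notMem_empty, not_false_eq_true, and_true, arrivalWeight]
      rw [Finset.sum_filter]
    have hnn : ∀ v, 0 ≤ arrivalWeight f (t + 1) (w v) := fun v => by
      unfold arrivalWeight; split_ifs <;> simp [hf0]
    rw [hcont]
    by_cases htk : t < k
    · have hbt : b * (t + 1) ≤ b * k := Nat.mul_le_mul_left b htk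
      rw [Nat.mul_add, Nat.mul_one] at hbt
      let e : Fin b → Fin n := fun j => ⟨N + (b * t + j), by have := j.2; omega⟩
      have he : Function.Injective e := by
        intro i j hij
        have := congrArg Fin.val hij
        simp only [e] at this
        exact Fin.ext (by omega)
      have hwe : ∀ j, w (e j) = t := by
        intro j
        have hj := j.2
        simp only [hw, e]
        rw [dif_neg (by omega), if_pos (by omega), Nat.add_sub_cancel_left,
          Nat.mul_add_div (by omega), Nat.div_eq_of_lt hj, Nat.add_zero]
      calc m ≤ b * f 1 := hm
        _ = ∑ j : Fin b, arrivalWeight f (t + 1) (w (e j)) := by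
            simp [hwe, arrivalWeight]
        _ = ∑ v ∈ Finset.univ.image e, arrivalWeight f (t + 1) (w v) := by
            rw [Finset.sum_image fun i _ j _ hij => he hij]
        _ ≤ _ := Finset.sum_le_sum_of_subset_of_nonneg (Finset.subset_univ _) fun v _ _ => hnn v
    · let e : Fin N → Fin n := fun j => ⟨j, by have := j.2; omega⟩
      have he : Function.Injective e := by
        intro i j hij
        have := congrArg Fin.val hij
        exact Fin.ext this
      calc m ≤ ∑ v, arrivalWeight h (t + 1) (a v) := ha (t + 1) (by omega) (by omega)
        _ ≤ ∑ j : Fin N, arrivalWeight f (t + 1) (w (e j)) := by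
            refine Finset.sum_le_sum fun j _ => ?_
            simp only [hw, e, j.2, dif_pos, arrivalWeight]
            split_ifs
            · exact hhf _
            · exact le_rfl
        _ = ∑ v ∈ Finset.univ.image e, arrivalWeight f (t + 1) (w v) := by
            rw [Finset.sum_image fun i _ j _ hij => he hij]
        _ ≤ _ := Finset.sum_le_sum_of_subset_of_nonneg (Finset.subset_univ _) fun v _ _ => hnn v

end Schedules


/-! ### Latency bounds versus blockable times. -/

section Latency

variable {n : ℕ}

theorem succeeded_mono (w : Schedule n) (X : Fin n → Choices) : Monotone (succeeded w X) := by
  refine monotone_nat_of_le_succ fun t => ?_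
  simp only [succeeded]
  split_ifs
  · exact Finset.subset_union_left
  · exact le_rfl

theorem successTime_le_iff (w : Schedule n) (X : Fin n → Choices) (u : Fin n) (L : ℕ) :
    successTime w X u ≤ L ↔ u ∈ succeeded w X L := by
  refine ⟨fun h => ?_, fun h => iInf₂_le L h⟩
  by_contra hu
  have h1 : ((L + 1 : ℕ) : ℕ∞) ≤ successTime w X u := by
    refine le_iInf₂ fun t ht => ?_
    have : L < t := by
      by_contra hlt
      exact hu (succeeded_mono w X (not_lt.1 hlt) ht)
    exact_mod_cast this
  have h2 : L + 1 ≤ L := by exact_mod_cast h1.trans h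
  omega

theorem one_le_successTime (w : Schedule n) (X : Fin n → Choices) (u : Fin n) :
    1 ≤ successTime w X u := by
  rw [Order.one_le_iff_ne_zero]
  intro h
  have : successTime w X u ≤ ((0 : ℕ) : ℕ∞) := by simp [h]
  rw [successTime_le_iff] at this
  simp [succeeded] at this

theorem setOf_success_eq (w : Schedule n) (u : Fin n) (T : ℕ) :
    {X | 1 ≤ successTime w X u ∧ successTime w X u ≤ (T : ℕ∞)} = {X | u ∈ succeeded w X T} := by
  ext X
  simp [one_le_successTime, successTime_le_iff]

theorem prob_mem_succeeded_ge {D : Measure Choices} [IsProbabilityMeasure D] {q : ℝ}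
    (hfin : latencyBound D n q ≠ ⊤) {T : ℕ} (hT : (latencyBound D n q).toNat ≤ T)
    {w : Schedule n} {u : Fin n} (hu : w u = 0) :
    1 - q ≤ (jointLaw D n).real {X | u ∈ succeeded w X T} := by
  have hle : latencyBound D n q ≤ (T : ℕ∞) := by
    rw [← ENat.natCast_toNat hfin]; exact_mod_cast hT
  -- The infimum defining `latencyBound` is over integers: if no admissible `L` were at most `T`, it
  -- would be at least `T + 1`.
  obtain ⟨L, hLT, hL⟩ : ∃ L ≤ T, ∀ (w : Schedule n) (u : Fin n),
      1 - q ≤ (jointLaw D n).real {X | latency w X u ≤ (L : ℕ∞)} := by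
    by_contra! hcon
    have h1 : ((T + 1 : ℕ) : ℕ∞) ≤ latencyBound D n q := by
      refine le_iInf₂ fun L hL => ?_
      have : T < L := by
        by_contra hlt
        obtain ⟨w, u, h⟩ := hcon L (not_lt.1 hlt)
        exact absurd (hL w u) (not_le.2 h)
      exact_mod_cast this
    have h2 : T + 1 ≤ T := by exact_mod_cast h1.trans hle
    omega
  refine (hL w u).trans (measureReal_mono (fun X hX => ?_) (measure_ne_top _ _))
  have hX : latency w X u ≤ (L : ℕ∞) := hX
  simp only [latency, hu, Nat.cast_zero, tsub_zero] at hX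
  exact succeeded_mono w X hLT ((successTime_le_iff w X u L).1 hX)

/-- Leaves an error budget of `3/20` for the success probability of the blocked party. -/
theorem four_rpow_le : (4 : ℝ) ^ (-(1 / 8) : ℝ) ≤ 17 / 20 := by
  refine le_of_pow_le_pow_left₀ (n := 8) (by norm_num) (by norm_num) ?_
  rw [← Real.rpow_natCast, ← Real.rpow_mul (by norm_num)]
  norm_num [Real.rpow_neg_one]

theorem half_lt_four_rpow : 1 / 2 < (4 : ℝ) ^ (-(1 / 8) : ℝ) := by
  refine lt_of_pow_lt_pow_left₀ 8 (by positivity) ?_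
  rw [← Real.rpow_natCast ((4 : ℝ) ^ _), ← Real.rpow_mul (by norm_num)]
  norm_num [Real.rpow_neg_one]

/-- A blocked party succeeds by time `T` with probability below `1/2 ≤ 1 - q`, which is impossible
from the latency bound on. This makes the set of blockable times bounded. -/
theorem lt_of_isBlockable {D : Measure Choices} [IsProbabilityMeasure D] {q : ℝ} (hq : q ≤ 1 / 2)
    (hfin : latencyBound D n q ≠ ⊤) {T : ℕ} (hT : IsBlockable D n T) :
    T < (latencyBound D n q).toNat := by
  by_contra hcon
  obtain ⟨w, ⟨u, hu, hprob⟩, -⟩ := hT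
  rw [setOf_success_eq] at hprob
  have h1 := prob_mem_succeeded_ge hfin (not_lt.1 hcon) hu
  have := half_lt_four_rpow
  linarith

theorem isBlockable_zero (D : Measure Choices) (hn : 2 ≤ n) : IsBlockable D n 0 := by
  have h4 := four_rpow_le
  obtain ⟨w, u, hu, hcard, -⟩ := exists_schedule (f := 0) (h := 0) (fun _ => le_rfl)
    (fun _ => le_rfl) (n := n) (N := 0) (k := 0) (b := 0) (T := 0) (by omega) (m := 0) (by simp)
    Fin.elim0 (by simp)
  refine ⟨w, ⟨u, hu, ?_⟩, ?_⟩
  · rw [setOf_success_eq]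
    simp only [succeeded, Finset.notMem_empty]
    simp
    linarith
  · have h1 : (((Finset.univ.filter fun v => w v ≤ 0).card : ℕ) : ℝ) ≤ 1 := by
      exact_mod_cast hcard.trans (by simp)
    have h2 : (2 : ℝ) ≤ n := by exact_mod_cast hn
    linarith

/-- If no number of slots beyond the latency bound can be blocked, the restricted time window
exists, and it is at least as long as any blockable time. -/
theorem exists_isRestrictedTimeWindow {D : Measure Choices} [IsProbabilityMeasure D] {q : ℝ}
    (hq : q ≤ 1 / 2) (hfin : latencyBound D n q ≠ ⊤) {T₀ : ℕ} (hT : IsBlockable D n T₀) :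
    ∃ T, IsRestrictedTimeWindow D n T ∧ T₀ ≤ T := by
  have hb : BddAbove {T : ℕ | IsBlockable D n T} :=
    ⟨_, fun T hT => (lt_of_isBlockable hq hfin hT).le⟩
  exact ⟨sSup _, ⟨Nat.sSup_mem ⟨T₀, hT⟩ hb, fun _ h => le_csSup hb h⟩, le_csSup hb hT⟩

/-- With a large total attempt probability at the first `k` local times, some party that wakes up
at time `0` can be blocked until time `T`. -/
theorem exists_prob_lt_half {D : Measure Choices} [IsProbabilityMeasure D] {N k b T : ℕ}
    (hn : N + b * k + 1 ≤ n) {m : ℝ} (hm : m ≤ b * accessProb D 1) (hT : 0 < T)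
    (harr : T * Real.exp (-(3 / 5 * (N * (∑ i ∈ Finset.Icc 1 k, accessProb D i) / (T * 1)))) <
      Real.exp (-(m / 1)))
    (hsmall : T * (2 * Real.exp (-m / 2)) < 1 / 2) :
    ∃ (w : Schedule n) (u : Fin n), w u = 0 ∧
      (jointLaw D n).real {X | u ∈ succeeded w X T} < 1 / 2 := by
  obtain ⟨a, ha⟩ := exists_arrivals (accessProb_nonneg D) one_pos (accessProb_le_one D) hT harr
  obtain ⟨w, u, hu, -, hY⟩ := exists_schedule (accessProb_nonneg D) (fun _ => le_rfl) hn hm a ha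
  exact ⟨w, u, hu, (prob_mem_succeeded_le_of_contention (fun _ => le_rfl) w hY u).trans_lt hsmall⟩

end Latency

/-! ### Low probabilities and their monotone envelope. -/

section LowProbabilities

theorem lowProb_nonneg (D : Measure Choices) (β : ℝ) (i : ℕ) : 0 ≤ lowProb D β i := by
  unfold lowProb; split_ifs
  · exact accessProb_nonneg D i
  · exact le_rfl

theorem lowProb_le_accessProb (D : Measure Choices) (β : ℝ) (i : ℕ) :
    lowProb D β i ≤ accessProb D i := by
  unfold lowProb; split_ifs
  · exact le_rfl
  · exact accessProb_nonneg D i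

theorem lowProb_le_log_rpow_div (D : Measure Choices) {β : ℝ} (hβ : 0 ≤ β) {i n : ℕ} (hi : 16 < i)
    (hin : i ≤ n) : lowProb D β i ≤ Real.log n ^ β / i := by
  have h0 : (0 : ℝ) < i := by exact_mod_cast (by omega : 0 < i)
  have hlog0 : 0 ≤ Real.log i := Real.log_natCast_nonneg i
  have hlog : Real.log i ≤ Real.log n := Real.log_le_log h0 (by exact_mod_cast hin)
  have h1 : threshold β i ≤ Real.log n ^ β / i := by
    unfold threshold
    rw [if_neg (by omega)]
    refine (min_le_right _ _).trans ?_
    gcongr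
  unfold lowProb; split_ifs with h
  · exact h.trans h1
  · have := hlog0.trans hlog
    positivity

/-- The low probabilities at the local times in `(j, k]`. -/
noncomputable def lowProbBetween (D : Measure Choices) (β : ℝ) (j k i : ℕ) : ℝ :=
  if j < i ∧ i ≤ k then lowProb D β i else 0

theorem lowProbBetween_nonneg (D : Measure Choices) (β : ℝ) (j k i : ℕ) :
    0 ≤ lowProbBetween D β j k i := by
  unfold lowProbBetween; split_ifs
  · exact lowProb_nonneg D β i
  · exact le_rfl

theorem lowProbBetween_le_accessProb (D : Measure Choices) (β : ℝ) (j k i : ℕ) :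
    lowProbBetween D β j k i ≤ accessProb D i := by
  unfold lowProbBetween; split_ifs
  · exact lowProb_le_accessProb D β i
  · exact accessProb_nonneg D i

/-- Only an inequality, because `j ≤ k` is not assumed. -/
theorem lowSum_sub_le (D : Measure Choices) (β : ℝ) (j k : ℕ) :
    lowSum D β k - lowSum D β j ≤ ∑ i ∈ Finset.Icc 1 k, lowProbBetween D β j k i := by
  rw [sub_le_iff_le_add]
  calc lowSum D β k
      ≤ ∑ i ∈ Finset.Icc 1 k, (lowProbBetween D β j k i + if i ≤ j then lowProb D β i else 0) := by
        refine Finset.sum_le_sum fun i hi => ?_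
        have hik := (Finset.mem_Icc.1 hi).2
        unfold lowProbBetween
        by_cases hj : i ≤ j
        · simp [hj, not_lt.2 hj]
        · simp [hj, not_le.1 hj, hik]
    _ ≤ _ := by
        rw [Finset.sum_add_distrib, ← Finset.sum_filter]
        refine add_le_add_right (Finset.sum_le_sum_of_subset_of_nonneg (fun i hi => ?_)
          fun _ _ _ => lowProb_nonneg D β _) _
        simp only [Finset.mem_filter, Finset.mem_Icc] at hi ⊢
        omega

theorem lowSum_nonneg (D : Measure Choices) (β : ℝ) (k : ℕ) : 0 ≤ lowSum D β k :=
  Finset.sum_nonneg fun _ _ => lowProb_nonneg D β _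

theorem lowSum_le (D : Measure Choices) [IsProbabilityMeasure D] (β : ℝ) (k : ℕ) :
    lowSum D β k ≤ k := by
  refine (Finset.sum_le_card_nsmul _ _ 1 fun i _ =>
    (lowProb_le_accessProb D β i).trans (accessProb_le_one D i)).trans ?_
  simp

/-- An upper bound for the low probabilities at local times beyond `√n`, made monotone. -/
noncomputable def envelope (β : ℝ) (n a : ℕ) : ℝ := Real.log n ^ β / max (Real.sqrt n) a

theorem envelope_nonneg (β : ℝ) (n a : ℕ) : 0 ≤ envelope β n a := by
  have := Real.log_natCast_nonneg n
  unfold envelope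
  positivity

theorem antitone_envelope (β : ℝ) {n : ℕ} (hn : 0 < n) : Antitone (envelope β n) := by
  intro a b hab
  have h1 := Real.log_natCast_nonneg n
  have h2 : 0 < Real.sqrt n := Real.sqrt_pos.2 (by exact_mod_cast hn)
  unfold envelope
  have h3 : (a : ℝ) ≤ b := by exact_mod_cast hab
  have h4 : 0 < max (Real.sqrt n) (a : ℝ) := lt_max_of_lt_left h2
  gcongr

theorem envelope_le (β : ℝ) {n : ℕ} (hn : 0 < n) (a : ℕ) :
    envelope β n a ≤ Real.log n ^ β / Real.sqrt n := by
  have h1 := Real.log_natCast_nonneg n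
  have h2 : 0 < Real.sqrt n := Real.sqrt_pos.2 (by exact_mod_cast hn)
  unfold envelope
  gcongr
  exact le_max_left _ _

theorem sum_envelope_le (β : ℝ) (n T : ℕ) :
    ∑ a ∈ Finset.Icc 1 T, envelope β n a ≤ Real.log n ^ β * (1 + Real.log T) := by
  have h1 := Real.log_natCast_nonneg n
  have h2 := harmonic_le_one_add_log T
  rw [harmonic_eq_sum_Icc] at h2
  push_cast at h2
  calc _ ≤ ∑ a ∈ Finset.Icc 1 T, Real.log n ^ β * (a : ℝ)⁻¹ := by
        refine Finset.sum_le_sum fun a ha => ?_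
        have h3 : (0 : ℝ) < a := by exact_mod_cast (Finset.mem_Icc.1 ha).1
        unfold envelope
        rw [div_eq_mul_inv]
        gcongr
        exact le_max_right _ _
    _ ≤ _ := by
        rw [← Finset.mul_sum]
        gcongr

/-- The bound `256 ≤ n` puts all ages beyond `√n` above 16, where `threshold` has its logarithmic
form. -/
theorem lowProbBetween_le_envelope (D : Measure Choices) {β : ℝ} (hβ : 0 ≤ β) {n k : ℕ}
    (hn : 256 ≤ n) (hk : k ≤ n) (i : ℕ) :
    lowProbBetween D β ⌊Real.sqrt n⌋₊ k i ≤ envelope β n i := by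
  unfold lowProbBetween
  split_ifs with h
  · have h1 : Real.sqrt n < i := Nat.lt_of_floor_lt h.1
    have h2 : (16 : ℝ) ≤ Real.sqrt n := Real.le_sqrt_of_sq_le (by
      norm_num; exact_mod_cast hn)
    have h3 : 16 < i := by exact_mod_cast h2.trans_lt h1
    unfold envelope
    rw [max_eq_right h1.le]
    exact lowProb_le_log_rpow_div D hβ h3 (h.2.trans hk)
  · exact envelope_nonneg β n i

/-- Blocking with `N` parties that contend at local times in `(√n, k]` and bursts before `k`. -/
theorem isBlockable_of_bounds {D : Measure Choices} [IsProbabilityMeasure D]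
    (hD : IsMemoryless D) {β : ℝ} (hβ : 0 ≤ β) {n N k b T : ℕ} (hn : 256 ≤ n) (hk : k ≤ n)
    (hcard : (N + b * k + 1 : ℝ) ≤ 2 * n / 3) {c : ℝ} (hm : 2 * c ≤ b * accessProb D 1)
    (hT : 0 < T)
    (harr : T * Real.exp (-(3 / 5 * (N * (lowSum D β k - lowSum D β ⌊Real.sqrt n⌋₊) /
      (T * (Real.log n ^ β / Real.sqrt n))))) <
      Real.exp (-(2 * c / (Real.log n ^ β / Real.sqrt n))))
    (hsmall : T * Real.exp (-(Real.sqrt n / Real.log n ^ β * c) + 2 * (2 * Real.exp (-c / 2)) *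
      (Real.sqrt n / Real.log n ^ β * (Real.log n ^ β * (1 + Real.log T)))) +
      2 * Real.exp (-c / 2) * ∑ t ∈ Finset.Icc 1 T, accessProb D t ≤ 3 / 20) :
    IsBlockable D n T := by
  have hn0 : 0 < n := by omega
  have hs : 0 < Real.sqrt n := Real.sqrt_pos.2 (by exact_mod_cast hn0)
  have hlog : 0 < Real.log n := Real.log_pos (by exact_mod_cast (by omega : 1 < n))
  have hE : 0 < Real.log n ^ β := Real.rpow_pos_of_pos hlog β
  set j := ⌊Real.sqrt n⌋₊ with hj
  have hj1 : 1 ≤ j := Nat.one_le_floor_iff _ |>.2 (Real.one_le_sqrt.2 (by exact_mod_cast hn0))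
  set h := lowProbBetween D β j k with hh
  -- Age 1 keeps its full probability for the bursts; at all other ages only the low probabilities
  -- under the envelope count.
  set f : ℕ → ℝ := fun i => if i = 1 then accessProb D 1 else h i with hf
  have hf0 : ∀ i, 0 ≤ f i := fun i => by
    simp only [hf]; split_ifs
    · exact accessProb_nonneg D 1
    · exact lowProbBetween_nonneg D β j k i
  have hhf : ∀ i, h i ≤ f i := fun i => by
    simp only [hf]; split_ifs with hi
    · subst hi; exact lowProbBetween_le_accessProb D β j k 1
    · exact le_rfl
  have hfp : ∀ i, f i ≤ accessProb D i := fun i => by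
    simp only [hf]; split_ifs with hi
    · rw [hi]
    · exact lowProbBetween_le_accessProb D β j k i
  have hfg : ∀ i, 2 ≤ i → f i ≤ envelope β n i := fun i hi => by
    simp only [hf]; rw [if_neg (by omega)]
    exact lowProbBetween_le_envelope D hβ hn hk i
  have hε : 0 < Real.log n ^ β / Real.sqrt n := by positivity
  obtain ⟨a, ha⟩ := exists_arrivals (h := h) (N := N) (k := k) (m := 2 * c)
    (lowProbBetween_nonneg D β j k) hε
    (fun i => (lowProbBetween_le_envelope D hβ hn hk i).trans (envelope_le β hn0 i)) hT
    (lt_of_le_of_lt (by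
      have := lowSum_sub_le D β j k
      gcongr) harr)
  have hcard' : N + b * k + 1 ≤ n := by
    have : (N + b * k + 1 : ℝ) ≤ n := hcard.trans (by
      have : (0 : ℝ) ≤ n := by positivity
      linarith)
    exact_mod_cast this
  obtain ⟨w, u, hu, hw, hY⟩ := exists_schedule hf0 hhf hcard' (by simpa [hf] using hm) a ha
  refine ⟨w, ⟨u, hu, ?_⟩, le_trans ?_ hcard⟩
  · rw [setOf_success_eq]
    have hθ : 0 < Real.sqrt n / Real.log n ^ β := by positivity
    refine (prob_mem_succeeded_le hD hfp (antitone_envelope β hn0) hfg (envelope_nonneg β n) w hθ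
      (fun i => ?_) hY hu).trans (le_trans ?_ (hsmall.trans ?_))
    · calc _ ≤ Real.sqrt n / Real.log n ^ β * (Real.log n ^ β / Real.sqrt n) :=
            mul_le_mul_of_nonneg_left (envelope_le β hn0 i) hθ.le
        _ = 1 := by field_simp
    · have := sum_envelope_le β n T
      gcongr
    · have := four_rpow_le
      linarith
  · exact_mod_cast hw

end LowProbabilities


/-! ### Asymptotic estimates and numerical constants. -/

section Asymptotics

theorem tendsto_log_natCast : Tendsto (fun n : ℕ => Real.log n) atTop atTop :=
  Real.tendsto_log_atTop.comp tendsto_natCast_atTop_atTop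

theorem eventually_log_rpow_le (s : ℝ) {r : ℝ} (hr : 0 < r) :
    ∀ᶠ n : ℕ in atTop, Real.log n ^ s ≤ (n : ℝ) ^ r := by
  have h := (isLittleO_log_rpow_rpow_atTop s hr).bound one_pos
  filter_upwards [tendsto_natCast_atTop_atTop.eventually h] with n hn
  have h1 := Real.rpow_nonneg (Real.log_natCast_nonneg n) s
  have h2 := Real.rpow_nonneg (Nat.cast_nonneg (α := ℝ) n) r
  rwa [one_mul, Real.norm_of_nonneg h1, Real.norm_of_nonneg h2] at hn

/-- Bursts of size `O(log n)` in `n / log² n` slots use only `O(n / log n)` parties. -/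
theorem eventually_parties_le {A : ℝ} (hA : 0 ≤ A) :
    ∀ᶠ n : ℕ in atTop, (((n / 2 : ℕ) : ℝ) +
      (⌈A * Real.log n⌉₊ : ℝ) * (⌊(n : ℝ) / Real.log n ^ 2⌋₊ : ℝ) + 1) ≤ 2 * n / 3 := by
  filter_upwards [tendsto_log_natCast.eventually_ge_atTop (20 * A + 20),
    eventually_ge_atTop 15] with n hl hn
  set l := Real.log n
  have hn' : (15 : ℝ) ≤ n := by exact_mod_cast hn
  have hl0 : 0 < l := by linarith
  have h1 : (⌈A * l⌉₊ : ℝ) ≤ A * l + 1 := (Nat.ceil_lt_add_one (by positivity)).le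
  have h2 : (⌊(n : ℝ) / l ^ 2⌋₊ : ℝ) ≤ n / l ^ 2 := Nat.floor_le (by positivity)
  have h3 : ((n / 2 : ℕ) : ℝ) ≤ n / 2 := Nat.cast_div_le
  have h4 : (A * l + 1) * (n / l ^ 2) ≤ n / 10 := by
    rw [mul_div_assoc', div_le_div_iff₀ (by positivity) (by norm_num)]
    have : (A * l + 1) * 10 ≤ l ^ 2 := by nlinarith
    nlinarith
  have h5 : (⌈A * l⌉₊ : ℝ) * (⌊(n : ℝ) / l ^ 2⌋₊ : ℝ) ≤ (A * l + 1) * (n / l ^ 2) := by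
    gcongr
  linarith

/-- A small latency bound forces the attempt probabilities to have a polylogarithmic sum. -/
theorem eventually_sum_accessProb_le {D : Measure Choices} [IsProbabilityMeasure D]
    (hp : 0 < accessProb D 1) {β : ℝ} {q : ℕ → ℝ}
    (hq : ∀ᶠ n in atTop, q n ≤ 1 / 2)
    (hfin : ∀ᶠ n : ℕ in atTop, latencyBound D n (q n) ≠ ⊤)
    (hL : (fun n : ℕ => ((latencyBound D n (q n)).toNat : ℝ))
      =o[atTop] fun n : ℕ => (n : ℝ) * Real.log n ^ (β / 2 - 1)) (hβ : 2 ≤ β) :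
    ∀ᶠ n : ℕ in atTop, ∑ i ∈ Finset.Icc 1 ⌊(n : ℝ) / Real.log n ^ 2⌋₊, accessProb D i ≤
      Real.log n ^ (β / 2) := by
  filter_upwards [hq, hfin, hL.bound (show (0 : ℝ) < 1 / 100 by norm_num),
    tendsto_log_natCast.eventually_ge_atTop 20, eventually_ge_atTop 100,
    eventually_parties_le (A := 10 / accessProb D 1) (by positivity),
    eventually_log_rpow_le (β / 2 - 1) one_pos] with n hqn hfinn hLn hl hn hpart hrpow
  by_contra! hF
  set k := ⌊(n : ℝ) / Real.log n ^ 2⌋₊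
  set F := ∑ i ∈ Finset.Icc 1 k, accessProb D i
  set l := Real.log n with hldef
  set L := (latencyBound D n (q n)).toNat
  set b := ⌈10 / accessProb D 1 * l⌉₊
  have hn' : (100 : ℝ) ≤ n := by exact_mod_cast hn
  have hl0 : 0 < l := by linarith
  set E := l ^ (β / 2 - 1) with hE
  have hE1 : 1 ≤ E := Real.one_le_rpow (by linarith) (by linarith)
  have hEF : l ^ (β / 2) = E * l := by
    rw [hE, ← Real.rpow_add_one hl0.ne']; congr 1; ring
  rw [Real.rpow_one] at hrpow
  rw [Real.norm_of_nonneg (by positivity), Real.norm_of_nonneg (by positivity)] at hLn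
  have hnE : (100 : ℝ) ≤ n * E := by nlinarith
  have hT : ((L + 1 : ℕ) : ℝ) ≤ 1 / 50 * (n * E) := by push_cast; linarith
  have hexp : Real.exp (2 * l) = (n : ℝ) ^ 2 := by
    rw [two_mul, Real.exp_add, hldef, Real.exp_log (by linarith)]; ring
  have hTexp : ((L + 1 : ℕ) : ℝ) ≤ Real.exp (2 * l) := by
    rw [hexp]; nlinarith
  have hT0 : (0 : ℝ) < ((L + 1 : ℕ) : ℝ) := by positivity
  have hN : 9 / 20 * (n : ℝ) ≤ ((n / 2 : ℕ) : ℝ) := by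
    have : (n : ℝ) ≤ 2 * ((n / 2 : ℕ) : ℝ) + 1 := by exact_mod_cast (by omega : n ≤ 2 * (n / 2) + 1)
    linarith
  have hb : 10 * l ≤ b * accessProb D 1 := by
    have := Nat.le_ceil (10 / accessProb D 1 * l)
    calc 10 * l = 10 / accessProb D 1 * l * accessProb D 1 := by field_simp
      _ ≤ _ := by gcongr
  have hcard : n / 2 + b * k + 1 ≤ n := by
    have : ((n / 2 : ℕ) : ℝ) + b * k + 1 ≤ n := hpart.trans (by linarith)
    exact_mod_cast this
  -- The target contention is `10 l` and the union over `L + 1 ≤ exp (2 l)` slots costs `2 l`; `22`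
  -- suffices because `3/5 * 22 > 10 + 2`.
  have hratio : 22 * l ≤ ((n / 2 : ℕ) : ℝ) * F / (((L + 1 : ℕ) : ℝ) * 1) := by
    rw [mul_one, le_div_iff₀ hT0]
    calc 22 * l * ((L + 1 : ℕ) : ℝ) ≤ 22 * l * (1 / 50 * (n * E)) := by gcongr
      _ ≤ 9 / 20 * (n : ℝ) * (E * l) := by
          have : 0 ≤ n * E * l := by positivity
          nlinarith
      _ ≤ _ := by rw [← hEF]; gcongr
  obtain ⟨w, u, hu, hlt⟩ := exists_prob_lt_half (D := D) hcard hb (Nat.succ_pos L)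
    (by
      calc _ ≤ Real.exp (2 * l) * Real.exp (-(3 / 5 * (22 * l))) := by gcongr
        _ < _ := by
          rw [← Real.exp_add]
          refine Real.exp_lt_exp.2 ?_
          linarith)
    (by
      calc _ ≤ Real.exp (2 * l) * (2 * Real.exp (-(10 * l) / 2)) := by gcongr
        _ = 2 * Real.exp (-(3 * l)) := by
          rw [mul_left_comm, ← Real.exp_add]; ring_nf
        _ < _ := by
          have h1 := Real.add_one_le_exp (3 * l)
          rw [Real.exp_neg, ← div_eq_mul_inv, div_lt_div_iff₀ (Real.exp_pos _) two_pos]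
          linarith)
  have := prob_mem_succeeded_ge hfinn (Nat.le_succ L) hu
  linarith

/-- The hypothesis is applied with `n ^ 3` parties: `n ^ 3 / (3 log n) ^ 2` eventually exceeds `n ^
2`, at the cost of a factor 3 inside the power. -/
theorem eventually_sum_accessProb_sq_le {D : Measure Choices} {β : ℝ}
    (h : ∀ᶠ n : ℕ in atTop, ∑ i ∈ Finset.Icc 1 ⌊(n : ℝ) / Real.log n ^ 2⌋₊, accessProb D i ≤
      Real.log n ^ (β / 2)) :
    ∀ᶠ n : ℕ in atTop, ∑ i ∈ Finset.Icc 1 (n ^ 2), accessProb D i ≤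
      (3 * Real.log n) ^ (β / 2) := by
  have h3 : Tendsto (fun n : ℕ => n ^ 3) atTop atTop := tendsto_pow_atTop (by norm_num)
  filter_upwards [h3.eventually h, eventually_log_rpow_le 2 (show (0 : ℝ) < 1 / 2 by norm_num),
    eventually_ge_atTop 81, tendsto_log_natCast.eventually_ge_atTop 1] with n hn hlog hn81 hl
  have hn' : (81 : ℝ) ≤ n := by exact_mod_cast hn81
  rw [Nat.cast_pow, Real.log_pow] at hn
  push_cast at hn
  refine le_trans (Finset.sum_le_sum_of_subset_of_nonneg (Finset.Icc_subset_Icc_right ?_)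
    fun _ _ _ => accessProb_nonneg D _) hn
  refine Nat.le_floor ?_
  rw [Real.rpow_two, ← Real.sqrt_eq_rpow] at hlog
  have hs : (9 : ℝ) ≤ Real.sqrt n := Real.le_sqrt_of_sq_le (by linarith)
  have hss := Real.mul_self_sqrt (show (0 : ℝ) ≤ n by linarith)
  push_cast
  rw [le_div_iff₀ (by positivity)]
  have : (3 * Real.log n) ^ 2 ≤ n := by nlinarith
  nlinarith [sq_nonneg (n : ℝ)]

/-- The asymptotic comparisons behind the choice of the contention level. -/
theorem eventually_blocking_error_le {β : ℝ} (hβ : 10 ≤ β) :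
    ∀ᶠ n : ℕ in atTop,
      let c := 5 * (β * Real.log (Real.log n))
      Real.exp (-c / 2) * (1 + 2 * Real.log n) * Real.log n ^ β ≤ 1 / 4 ∧
      Real.exp (-c / 2) * (3 * Real.log n) ^ (β / 2) ≤ 1 / 20 ∧
      1 ≤ Real.log (Real.log n) ∧ Real.log (Real.log n) ≤ Real.log n ∧
      3 * Real.log n ≤ Real.sqrt n / Real.log n ^ β := by
  have hll : Tendsto (fun n : ℕ => Real.log (Real.log n)) atTop atTop :=
    Real.tendsto_log_atTop.comp tendsto_log_natCast
  filter_upwards [hll.eventually_ge_atTop 1, tendsto_log_natCast.eventually_ge_atTop 12,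
    tendsto_log_natCast.eventually_ge_atTop (20 * 3 ^ (β / 2)),
    eventually_log_rpow_le (β + 2) (show (0 : ℝ) < 1 / 2 by norm_num)] with n h1 h2 h3 h4
  set l := Real.log n
  have hl0 : 0 < l := by linarith
  have hl1 : 1 ≤ l := by linarith
  -- The factor 5 in `c` makes `exp (-c/2)` a power of `log n` small enough to beat both `log n ^ (β
  -- + 1)` and `log n ^ (β / 2)`.
  have hc : Real.exp (-(5 * (β * Real.log l)) / 2) = l ^ (-(5 / 2 * β)) := by
    rw [Real.rpow_def_of_pos hl0]; congr 1; ring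
  have h31 : (0 : ℝ) < 3 ^ (β / 2) := by positivity
  refine ⟨?_, ?_, h1, (Real.log_le_sub_one_of_pos hl0).trans (by linarith), ?_⟩
  · rw [hc]
    calc l ^ (-(5 / 2 * β)) * (1 + 2 * l) * l ^ β
        ≤ l ^ (-(5 / 2 * β)) * (3 * l ^ (1 : ℝ)) * l ^ β := by
          rw [Real.rpow_one]; gcongr; linarith
      _ = 3 * l ^ (-(5 / 2 * β) + 1 + β) := by
          rw [Real.rpow_add hl0, Real.rpow_add hl0]; ring
      _ ≤ 3 * l ^ (-1 : ℝ) := by gcongr; linarith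
      _ ≤ 1 / 4 := by
          rw [Real.rpow_neg_one, ← div_eq_mul_inv, div_le_div_iff₀ hl0 (by norm_num)]; linarith
  · rw [hc, Real.mul_rpow (by norm_num) hl0.le]
    calc l ^ (-(5 / 2 * β)) * (3 ^ (β / 2) * l ^ (β / 2))
        = 3 ^ (β / 2) * l ^ (-(5 / 2 * β) + β / 2) := by rw [Real.rpow_add hl0]; ring
      _ ≤ 3 ^ (β / 2) * l ^ (-1 : ℝ) := by gcongr; linarith
      _ ≤ 1 / 20 := by
          rw [Real.rpow_neg_one, ← div_eq_mul_inv, div_le_div_iff₀ hl0 (by norm_num)]; linarith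
  · rw [le_div_iff₀ (by positivity), Real.sqrt_eq_rpow]
    refine le_trans ?_ h4
    rw [Real.rpow_add hl0, Real.rpow_two]
    have : 3 * l ≤ l ^ 2 := by nlinarith
    rw [mul_comm (l ^ β)]
    gcongr

/-- Here `r = exp (-c/2)`, `θ = √n / log^β n`, `E = log^β n`, `lT = log T`, and `S ≤ P` bounds the
attempt probabilities of `u`. The exponent is at most `-θ c + θ`, which overwhelms `T`. -/
theorem blocking_error_le {T l r θ c E lT S P : ℝ} (hT : T ≤ Real.exp (2 * l)) (hlT : lT ≤ 2 * l)
    (hr : 0 < r) (hE : 0 < E) (hrE : r * (1 + 2 * l) * E ≤ 1 / 4) (hSP : S ≤ P)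
    (hrP : r * P ≤ 1 / 20) (hl : 20 ≤ l) (hθ : 3 * l ≤ θ) (hc : 50 ≤ c) :
    T * Real.exp (-(θ * c) + 2 * (2 * r) * (θ * (E * (1 + lT)))) + 2 * r * S ≤ 3 / 20 := by
  have hθ0 : 0 < θ := by linarith
  have h2 : 2 * (2 * r) * (θ * (E * (1 + lT))) ≤ θ := by
    calc _ ≤ 2 * (2 * r) * (θ * (E * (1 + 2 * l))) := by gcongr
      _ = 4 * θ * (r * (1 + 2 * l) * E) := by ring
      _ ≤ 4 * θ * (1 / 4) := by gcongr
      _ = θ := by ring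
  have h3 : T * Real.exp (-(θ * c) + 2 * (2 * r) * (θ * (E * (1 + lT)))) ≤ 1 / 20 := by
    calc _ ≤ Real.exp (2 * l) * Real.exp (-(θ * c) + θ) := by gcongr
      _ ≤ Real.exp (-l) := by
        rw [← Real.exp_add]
        refine Real.exp_le_exp.2 ?_
        nlinarith
      _ ≤ 1 / 20 := by
        rw [Real.exp_neg, inv_eq_one_div]
        have := Real.add_one_le_exp l
        exact one_div_le_one_div_of_le (by norm_num) (by linarith)
  have h4 : 2 * r * S ≤ 2 * r * P := by gcongr
  linarith

/-- With `C = β log log n`, the constant 40 gives mean contention at least `9/20 * 40 * C = 18 C`,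
and `3/5 * 18 = 10.8` exceeds the `10` in `2c = 10 C`. The gap `0.8 * C * (R / E) ≥ 24 l` absorbs
the union over `T ≤ exp (2 l)` times. -/
theorem arrivals_error_lt {T l C E R N n Δ : ℝ} (hT0 : 0 < T) (hT : T ≤ Real.exp (2 * l))
    (hΔ : 0 ≤ Δ) (hN : 9 / 20 * n ≤ N) (hTΔ : T * (40 * C) ≤ n * Δ) (hE : 0 < E) (hR : 0 < R)
    (hl : 0 < l) (hθ : 3 * l ≤ R / E) (hC : 10 ≤ C) :
    T * Real.exp (-(3 / 5 * (N * Δ / (T * (E / R))))) < Real.exp (-(2 * (5 * C) / (E / R))) := by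
  have hθ0 : 0 < R / E := by positivity
  have hratio : 18 * C * (R / E) ≤ N * Δ / (T * (E / R)) := by
    rw [show N * Δ / (T * (E / R)) = N * Δ / T * (R / E) by field_simp]
    refine mul_le_mul_of_nonneg_right ?_ hθ0.le
    rw [le_div_iff₀ hT0]
    have := mul_le_mul_of_nonneg_right hN hΔ
    linarith
  rw [show 2 * (5 * C) / (E / R) = 10 * C * (R / E) by field_simp; ring]
  calc _ ≤ Real.exp (2 * l) * Real.exp (-(3 / 5 * (18 * C * (R / E)))) := by gcongr
    _ < _ := by
      rw [← Real.exp_add]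
      refine Real.exp_lt_exp.2 ?_
      nlinarith

end Asymptotics

end ContentionResolution

/-! ### The main theorem. -/

theorem mainTheorem4 (D : Measure Choices) [IsProbabilityMeasure D] (hD : IsMemoryless D)
    (hp : 0 < accessProb D 1) (β : ℝ) (hβ : 10 ≤ β) (q : ℕ → ℝ)
    (hq : (∀ n, q n = 1 / 2) ∨ (∀ n, q n = ((n : ℝ) ^ 2)⁻¹))
    (hfin : ∀ᶠ n : ℕ in atTop, latencyBound D n (q n) ≠ ⊤)
    (hL : (fun n : ℕ => ((latencyBound D n (q n)).toNat : ℝ))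
      =o[atTop] fun n : ℕ => (n : ℝ) * Real.log n ^ (β / 2 - 1)) :
    ∀ᶠ n : ℕ in atTop, ∃ T : ℕ, IsRestrictedTimeWindow D n T ∧
      ⌊(n : ℝ) * (lowSum D β ⌊(n : ℝ) / Real.log n ^ 2⌋₊ - lowSum D β ⌊Real.sqrt n⌋₊)
        / (40 * β * Real.log (Real.log n))⌋ ≤ (T : ℤ) := by
  have hq2 : ∀ᶠ n in atTop, q n ≤ 1 / 2 := by
    filter_upwards [eventually_ge_atTop 2] with n hn
    rcases hq with h | h
    · rw [h]
    · have hn' : (2 : ℝ) ≤ n := by exact_mod_cast hn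
      rw [h, inv_eq_one_div, div_le_div_iff₀ (by positivity) two_pos]
      nlinarith
  have hsum := eventually_sum_accessProb_sq_le
    (eventually_sum_accessProb_le hp hq2 hfin hL (by linarith))
  filter_upwards [hq2, hfin, hsum, eventually_blocking_error_le hβ, eventually_ge_atTop 256,
    eventually_parties_le (A := 10 * β / accessProb D 1) (by positivity),
    tendsto_log_natCast.eventually_ge_atTop 20] with n hqn hfinn hs herr hn hpart hl
  obtain ⟨he1, he2, hll, hlll, hθ⟩ := herr
  set k := ⌊(n : ℝ) / Real.log n ^ 2⌋₊ with hk
  set Δ := lowSum D β k - lowSum D β ⌊Real.sqrt n⌋₊ with hΔ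
  set l := Real.log n with hldef
  set x := (n : ℝ) * Δ / (40 * β * Real.log l) with hx
  set b := ⌈10 * β / accessProb D 1 * l⌉₊ with hb
  have hn' : (256 : ℝ) ≤ n := by exact_mod_cast hn
  have hl0 : 0 < l := by linarith
  -- The natural-number floor truncates a negative `x` to 0, which only strengthens the bound.
  suffices hblock : IsBlockable D n ⌊x⌋₊ by
    obtain ⟨T, hT, hle⟩ := exists_isRestrictedTimeWindow hqn hfinn hblock
    refine ⟨T, hT, (Int.self_le_toNat _).trans ?_⟩
    rw [Int.floor_toNat]
    exact_mod_cast hle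
  rcases Nat.eq_zero_or_pos ⌊x⌋₊ with h0 | hTpos
  · rw [h0]; exact isBlockable_zero D (by omega)
  set T := ⌊x⌋₊ with hT
  have hx1 : 1 ≤ x := Nat.floor_pos.1 hTpos
  have hTx : (T : ℝ) ≤ x := Nat.floor_le (by linarith)
  have hT0 : (0 : ℝ) < T := by exact_mod_cast hTpos
  have hβll : 10 ≤ β * Real.log l := by nlinarith
  have hkn : k ≤ n := by
    refine Nat.floor_le_of_le ?_
    rw [← hldef, div_le_iff₀ (by positivity)]
    have : 1 ≤ l ^ 2 := by nlinarith
    nlinarith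
  have hΔn : Δ ≤ n := by
    have h1 := lowSum_le D β k
    have h2 := lowSum_nonneg D β ⌊Real.sqrt n⌋₊
    have h3 : (k : ℝ) ≤ n := by exact_mod_cast hkn
    linarith
  have hTΔ : T * (40 * (β * Real.log l)) ≤ n * Δ := by
    have h1 := hTx
    rw [hx, le_div_iff₀ (by nlinarith)] at h1
    linarith
  have hΔ0 : 0 < Δ := by
    have : 0 < n * Δ := lt_of_lt_of_le (by positivity) hTΔ
    exact pos_of_mul_pos_right this (by linarith)
  have hTsq : (T : ℝ) ≤ (n : ℝ) ^ 2 := by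
    have : (n : ℝ) * Δ ≤ n * n := by gcongr
    nlinarith
  have hTsq' : T ≤ n ^ 2 := by exact_mod_cast hTsq
  have hexp : Real.exp (2 * l) = (n : ℝ) ^ 2 := by
    rw [two_mul, Real.exp_add, hldef, Real.exp_log (by linarith)]; ring
  have hTexp : (T : ℝ) ≤ Real.exp (2 * l) := by rw [hexp]; exact hTsq
  have hlogT : Real.log T ≤ 2 * l := by
    rw [Real.log_le_iff_le_exp hT0]; exact hTexp
  have hN : 9 / 20 * (n : ℝ) ≤ ((n / 2 : ℕ) : ℝ) := by
    have : (n : ℝ) ≤ 2 * ((n / 2 : ℕ) : ℝ) + 1 := by exact_mod_cast (by omega : n ≤ 2 * (n / 2) + 1)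
    linarith
  have hsq : 0 < Real.sqrt n := Real.sqrt_pos.2 (by linarith)
  have hE : 0 < l ^ β := by positivity
  -- Bursts need only contention of order `log log n`; the larger size of order `log n` still fits
  -- the party count.
  have hbm : 2 * (5 * (β * Real.log l)) ≤ b * accessProb D 1 := by
    have h1 := Nat.le_ceil (10 * β / accessProb D 1 * l)
    calc 2 * (5 * (β * Real.log l)) ≤ 10 * β * l := by nlinarith
      _ = 10 * β / accessProb D 1 * l * accessProb D 1 := by field_simp
      _ ≤ _ := by gcongr
  refine isBlockable_of_bounds (β := β) hD (by linarith) hn hkn hpart hbm hTpos ?_ ?_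
  · exact arrivals_error_lt hT0 hTexp hΔ0.le hN hTΔ hE hsq hl0 hθ hβll
  · exact blocking_error_le hTexp hlogT (Real.exp_pos _) hE he1
      ((Finset.sum_le_sum_of_subset_of_nonneg (Finset.Icc_subset_Icc_right hTsq')
        fun _ _ _ => accessProb_nonneg D _).trans hs) he2 hl hθ (by linarith)
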